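/- Let $F$ be a totally real number field of degree $g$ with ring of integers $\mathcal O_F$; let $\mathcal O_{F+}\subset\mathcal O_F$ be the set of totally positive integers and $\Delta$ the group of totally positive units of $\mathcal O_F$. Fix a numbering $\tau_1,\dots,\tau_g$ of the embeddings $F\hookrightarrow\mathbb R$, write $\alpha^{\tau_i}=\tau_i(\alpha)$, and view $F$ in $\mathbb R^g$ through $\alpha\mapsto(\alpha^{\tau_1},\dots,\alpha^{\tau_g})$. Let $A\subset\mathcal O_{F+}$ be the set of primitive elements, i.e. those $\alpha$ with $\alpha/N\notin\mathcal O_{F+}$ for every integer $N>1$. Let $\mathbb T=\mathrm{Hom}_{\mathbb Z}(\mathcal O_F,\mathbb G_m)=\mathrm{Spec}\,\mathbb Z[t^\alpha\mid\alpha\in\mathcal O_F]$ with $t^\alpha t^{\alpha'}=t^{\alpha+\alpha'}$, with the right action of $\Delta$ in which $[\varepsilon]\colon\mathbb T\to\mathbb T$ is given by $t^\alpha\mapsto t^{\varepsilon\alpha}$, and let $U=\mathbb T\setminus\{1\}$ be the complement of the identity section. For $\alpha\in\mathcal O_F$ put $U_\alpha=\mathbb T\setminus\{t^\alpha=1\}$;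 for a tuple $\boldsymbol\alpha=(\alpha_0,\dots,\alpha_q)\in A^{q+1}$ put $U_{\boldsymbol\alpha}=U_{\alpha_0}\cap\dots\cap U_{\alpha_q}\subset U$, with inclusion $j_{\boldsymbol\alpha}\colon U_{\boldsymbol\alpha}\hookrightarrow U$. Let $\mathfrak U=(U_\alpha)_{\alpha\in A}$. For a $\Delta$-equivariant sheaf $\mathcal F$ on $U$ put $\Gamma(U/\Delta,\mathcal F)=\Gamma(U,\mathcal F)^\Delta$, and let $H^m(U/\Delta,-)$ be the $m$-th right derived functor of $\Gamma(U/\Delta,-)$ on $\Delta$-equivariant sheaves of abelian groups. Let $\mathscr C^q(\mathfrak U,\mathcal F)\subset\prod_{\boldsymbol\alpha\in A^{q+1}}j_{\boldsymbol\alpha*}j_{\boldsymbol\alpha}^*\mathcal F$ be the equivariant subsheaf of alternating families ($s_{\rho(\boldsymbol\alpha)}=\mathrm{sgn}(\rho)s_{\boldsymbol\alpha}$ for every permutation $\rho$, and $s_{\boldsymbol\alpha}=0$ if two entries of $\boldsymbol\alpha$ coincide), where $\varepsilon\in\Delta$ acts by $(s_{\boldsymbol\alpha})\mapsto([\varepsilon]^*s_{\varepsilon^{-1}\boldsymbol\alpha})$.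 With the usual alternating-sum differentials $d^q$ these sheaves form a complex $\mathscr C^\bullet(\mathfrak U,\mathcal F)$, with augmentation $\mathcal F\to\mathscr C^\bullet(\mathfrak U,\mathcal F)$ given by restriction of sections. Put $C^\bullet(\mathfrak U/\Delta,\mathcal F)=\Gamma(U/\Delta,\mathscr C^\bullet(\mathfrak U,\mathcal F))$. A class $c\in H^m(U/\Delta,\mathcal F)$ is called the class of a cocycle $z\in C^m(\mathfrak U/\Delta,\mathcal F)$ if there are an injective resolution $\mathcal F\to\mathcal I^\bullet$ and a morphism of complexes $\mathscr C^\bullet(\mathfrak U,\mathcal F)\to\mathcal I^\bullet$ under $\mathcal F$ such that the induced map $H^m(C^\bullet(\mathfrak U/\Delta,\mathcal F))\to H^m(\Gamma(U/\Delta,\mathcal I^\bullet))=H^m(U/\Delta,\mathcal F)$ sends $[z]$ to $c$. For $\boldsymbol\alpha=(\alpha_1,\dots,\alpha_g)\in A^g$ let $P_{\boldsymbol\alpha}=\{x_1\alpha_1+\dots+x_g\alpha_g\mid 0\le x_i<1\}\subset\mathbb R^g$, and for $R\subset\mathbb R^g$ let $\widehat R$ be the set of $u\in\mathbb R_{>0}^g$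 for which there is $\delta>0$ with $(u_1,\dots,u_{g-1},u_g-\delta')\in R$ for all $0<\delta'<\delta$. Let $\mathrm{sgn}(\boldsymbol\alpha)\in\{0,\pm1\}$ be the sign of $\det(\alpha_j^{\tau_i})_{i,j}$ and put $$\mathcal G_{\sigma_{\boldsymbol\alpha}}(t)=\frac{\sum_{\beta\in\widehat P_{\boldsymbol\alpha}\cap\mathcal O_F}t^\beta}{(1-t^{\alpha_1})\cdots(1-t^{\alpha_g})},\qquad \mathcal G_{\boldsymbol\alpha}=\mathrm{sgn}(\boldsymbol\alpha)\,\mathcal G_{\sigma_{\boldsymbol\alpha}}(t)\in\Gamma(U_{\boldsymbol\alpha},\mathcal O_{\mathbb T}).$$ Then: 1. $(\mathcal G_{\boldsymbol\alpha})_{\boldsymbol\alpha\in A^g}$ is alternating and $\Delta$-invariant, i.e. it is an element of $C^{g-1}(\mathfrak U/\Delta,\mathcal O_{\mathbb T})$. 2. It satisfies the cocycle condition $d^{g-1}(\mathcal G_{\boldsymbol\alpha})=0$. 3. Hence it defines a class: there is exactly one $\mathcal G\in H^{g-1}(U/\Delta,\mathcal O_{\mathbb T})$ that is the class of the cocycle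 $(\mathcal G_{\boldsymbol\alpha})$. It is called the Shintani generating class. -/

import Mathlib

namespace Shintani

open CategoryTheory AlgebraicGeometry Opposite

universe u

/-- A right action of a group `G` on a scheme `X`: endomorphisms `[g]` of `X` with `[1] = id` and
`[a b] = [b] ∘ [a]` (composition `≫` is written in diagrammatic order). -/
structure RightAction (G : Type u) [Group G] (X : Scheme.{u}) where
  act : G → (X ⟶ X)
  act_one : act 1 = 𝟙 X
  act_mul : ∀ a b : G, act (a * b) = act a ≫ act b

/-- Objects of the site of `X/G`: the open subsets of `X`. A morphism `V ⟶ W` is an element `g` of `G`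
with `[g](V) ⊆ W`; the morphism `g` followed by the morphism `h` is `g * h`.
A presheaf `P` on this category is a presheaf on `X` (restrict to the morphisms with `g = 1`)
together with pullback maps `[g]^* : P(W) → P([g]⁻¹ W)` satisfying `[1]^* = id` and
`[a b]^* = [a]^* [b]^*`, that is, with a `G`-equivariant structure `[g]^* P ≅ P`. -/
@[ext]
structure QOpen {G : Type u} [Group G] {X : Scheme.{u}} (ρ : RightAction G X) where
  carrier : X.Opens

section Site

variable {G : Type u} [Group G] {X : Scheme.{u}} {ρ : RightAction G X}

instance : SmallCategory.{u} (QOpen ρ) where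
  Hom V W := {g : G // V.carrier ≤ (ρ.act g) ⁻¹ᵁ W.carrier}
  id V := ⟨1, by rw [ρ.act_one]; exact le_rfl⟩
  comp f h := ⟨f.1 * h.1, by
    rw [ρ.act_mul]
    exact fun x hx => h.2 (f.2 hx)⟩
  id_comp f := Subtype.ext (one_mul _)
  comp_id f := Subtype.ext (mul_one _)
  assoc f g h := Subtype.ext (mul_assoc _ _ _)

namespace QOpen

/-- The group element underlying a morphism. -/
def elt {V W : QOpen ρ} (f : V ⟶ W) : G := f.1

lemma le_preimage {V W : QOpen ρ} (f : V ⟶ W) :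
    V.carrier ≤ (ρ.act (elt f)) ⁻¹ᵁ W.carrier := f.2

/-- The morphism `V ⟶ W` given by a group element `g` with `[g](V) ⊆ W`. -/
def mkHom {V W : QOpen ρ} (g : G) (h : V.carrier ≤ (ρ.act g) ⁻¹ᵁ W.carrier) : V ⟶ W := ⟨g, h⟩

/-- The inclusion morphism `V ⟶ W` for `V ⊆ W`. -/
def incl {V W : QOpen ρ} (h : V.carrier ≤ W.carrier) : V ⟶ W :=
  mkHom 1 (by rw [ρ.act_one]; exact h)

@[ext]
lemma hom_ext {V W : QOpen ρ} {f f' : V ⟶ W} (h : elt f = elt f') : f = f' := Subtype.ext h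

@[simp] lemma elt_id (V : QOpen ρ) : elt (𝟙 V) = 1 := rfl

@[simp] lemma elt_comp {V W T : QOpen ρ} (f : V ⟶ W) (h : W ⟶ T) :
    elt (f ≫ h) = elt f * elt h := rfl

@[simp] lemma elt_mkHom {V W : QOpen ρ} (g : G) (h : V.carrier ≤ (ρ.act g) ⁻¹ᵁ W.carrier) :
    elt (mkHom g h) = g := rfl

@[simp] lemma elt_incl {V W : QOpen ρ} (h : V.carrier ≤ W.carrier) : elt (incl h) = 1 := rfl

end QOpen

open QOpen

variable (ρ) in
lemma act_inv_act (g : G) (x : X) : (ρ.act g⁻¹) ((ρ.act g) x) = x := by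
  have := ρ.act_mul g g⁻¹
  rw [mul_inv_cancel, ρ.act_one] at this
  exact (congrArg (fun f : X ⟶ X => f x) this).symm

variable (ρ) in
lemma act_act_inv (g : G) (x : X) : (ρ.act g) ((ρ.act g⁻¹) x) = x := by
  have := ρ.act_mul g⁻¹ g
  rw [inv_mul_cancel, ρ.act_one] at this
  exact (congrArg (fun f : X ⟶ X => f x) this).symm

variable (ρ) in
lemma act_mul_apply (g h : G) (x : X) : (ρ.act (g * h)) x = (ρ.act h) ((ρ.act g) x) := by
  rw [ρ.act_mul]; rfl

variable (ρ) in
lemma act_one_apply (x : X) : (ρ.act 1) x = x := by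
  rw [ρ.act_one]; rfl

variable (ρ) in
/-- The topology of the site of `X/G`: a sieve on `V` covers if the images `[g](W) ⊆ V` of its
members `g : W ⟶ V` cover `V`. Sheaves of abelian groups for this topology are exactly the
`G`-equivariant sheaves of abelian groups on `X`. -/
def topology : GrothendieckTopology (QOpen ρ) where
  sieves V := {S | ∀ x ∈ V.carrier, ∃ (W : QOpen ρ) (f : W ⟶ V), S f ∧
    ∃ y ∈ W.carrier, (ρ.act (elt f)) y = x}
  top_mem' V x hx := ⟨V, 𝟙 V, trivial, x, hx, act_one_apply ρ x⟩
  pullback_stable' := by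
    intro V V' S h hS x hx
    obtain ⟨W, f, hf, y, hy, hyx⟩ := hS _ (le_preimage h hx)
    refine ⟨⟨V'.carrier ⊓ (ρ.act (elt h * (elt f)⁻¹)) ⁻¹ᵁ W.carrier⟩,
      incl inf_le_left, ?_, x, ⟨hx, ?_⟩, act_one_apply ρ x⟩
    · have : (incl inf_le_left : (⟨V'.carrier ⊓ (ρ.act (elt h * (elt f)⁻¹)) ⁻¹ᵁ W.carrier⟩ :
          QOpen ρ) ⟶ V') ≫ h = mkHom (elt h * (elt f)⁻¹) inf_le_right ≫ f := by
        ext; simp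
      change S _
      rw [this]
      exact S.downward_closed hf _
    · change (ρ.act (elt h * (elt f)⁻¹)) x ∈ W.carrier
      rw [act_mul_apply, ← hyx, act_inv_act]
      exact hy
  transitive' := by
    intro V S hS R hR x hx
    obtain ⟨W, f, hf, y, hy, hyx⟩ := hS x hx
    obtain ⟨T, h, hh, z, hz, hzy⟩ := hR hf y hy
    exact ⟨T, h ≫ f, hh, z, hz, by rw [elt_comp, act_mul_apply, hzy, hyx]⟩

/-- Pullback of sections `P(W) → P(V)` along a morphism `V ⟶ W`. -/
def pull (P : (QOpen ρ)ᵒᵖ ⥤ AddCommGrpCat.{u}) {V W : QOpen ρ} (f : V ⟶ W) :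
    P.obj (op W) →+ P.obj (op V) := (P.map f.op).hom

lemma pull_id (P : (QOpen ρ)ᵒᵖ ⥤ AddCommGrpCat.{u}) (V : QOpen ρ) (s : P.obj (op V)) :
    pull P (𝟙 V) s = s := by
  have := P.map_id (op V)
  exact congrArg (fun φ : P.obj (op V) ⟶ P.obj (op V) => φ.hom s) this

lemma pull_comp (P : (QOpen ρ)ᵒᵖ ⥤ AddCommGrpCat.{u}) {V W T : QOpen ρ} (f : V ⟶ W)
    (h : W ⟶ T) (s : P.obj (op T)) : pull P (f ≫ h) s = pull P f (pull P h s) := by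
  have := P.map_comp h.op f.op
  exact congrArg (fun φ : P.obj (op T) ⟶ P.obj (op V) => φ.hom s) this

/-- The presheaf `V ↦ Γ(V, 𝒪_X)` with the pullback of functions
`[g]^* : Γ(W, 𝒪_X) → Γ(V, 𝒪_X)` along `[g] : V → W`. -/
def structurePresheaf (ρ : RightAction G X) : (QOpen ρ)ᵒᵖ ⥤ AddCommGrpCat.{u} where
  obj V := AddCommGrpCat.of Γ(X, V.unop.carrier)
  map {W V} f := AddCommGrpCat.ofHom
    ((ρ.act (elt f.unop)).appLE W.unop.carrier V.unop.carrier (le_preimage f.unop)).hom.toAddMonoidHom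
  map_id V := by
    ext s
    change (ρ.act 1).appLE _ _ _ s = s
    have : ∀ (φ : X ⟶ X) (h : φ = 𝟙 X) (e), φ.appLE V.unop.carrier V.unop.carrier e s = s := by
      rintro _ rfl e
      have he : (homOfLE e).op = 𝟙 (op V.unop.carrier) := rfl
      simp only [Scheme.Hom.appLE, Scheme.Hom.id_app]
      erw [he, X.presheaf.map_id]
      rfl
    exact this _ ρ.act_one _
  map_comp {W V T} f h := by
    ext s
    change (ρ.act (elt h.unop * elt f.unop)).appLE _ _ _ s =
      (ρ.act (elt h.unop)).appLE _ _ _ ((ρ.act (elt f.unop)).appLE _ _ _ s)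
    rw [← CommRingCat.comp_apply, Scheme.Hom.appLE_comp_appLE]
    congr 2
    simp only [ρ.act_mul]

/-- The sheaf condition follows from unique gluing of compatible families of sections. -/
lemma isSheaf_of_gluing (P : (QOpen ρ)ᵒᵖ ⥤ AddCommGrpCat.{u})
    (h : ∀ (V : QOpen ρ) (S : Sieve V), S ∈ topology ρ V →
      ∀ x : (∀ (W : QOpen ρ) (f : W ⟶ V), S f → P.obj (op W)),
        (∀ (W T : QOpen ρ) (f : W ⟶ V) (hf : S f) (k : T ⟶ W),
          pull P k (x W f hf) = x T (k ≫ f) (S.downward_closed hf k)) →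
        ∃! s : P.obj (op V), ∀ (W : QOpen ρ) (f : W ⟶ V) (hf : S f), pull P f s = x W f hf) :
    Presheaf.IsSheaf (topology ρ) P := by
  rw [Presheaf.isSheaf_iff_isSheaf_forget (J := topology ρ) (s := forget AddCommGrpCat.{u}),
    isSheaf_iff_isSheaf_of_type]
  intro V S hS x hx
  rw [Presieve.compatible_iff_sieveCompatible] at hx
  obtain ⟨s, hs, hu⟩ := h V S hS (fun W f hf => x f hf)
    (fun W T f hf k => (hx f k hf).symm)
  exact ⟨s, fun W f hf => hs W f hf, fun t ht => hu t fun W f hf => ht f hf⟩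

/-- Unique gluing of compatible families of sections of a sheaf. -/
lemma existsUnique_gluing (F : Sheaf (topology ρ) AddCommGrpCat.{u})
    (V : QOpen ρ) (S : Sieve V) (hS : S ∈ topology ρ V)
    (x : ∀ (W : QOpen ρ) (f : W ⟶ V), S f → F.obj.obj (op W))
    (hx : ∀ (W T : QOpen ρ) (f : W ⟶ V) (hf : S f) (k : T ⟶ W),
      pull F.obj k (x W f hf) = x T (k ≫ f) (S.downward_closed hf k)) :
    ∃! s : F.obj.obj (op V), ∀ (W : QOpen ρ) (f : W ⟶ V) (hf : S f),
      pull F.obj f s = x W f hf := by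
  have h := F.property
  rw [Presheaf.isSheaf_iff_isSheaf_forget (J := topology ρ) (s := forget AddCommGrpCat.{u}),
    isSheaf_iff_isSheaf_of_type] at h
  let x' : Presieve.FamilyOfElements (F.obj ⋙ forget AddCommGrpCat.{u}) S.arrows :=
    fun W f hf => x W f hf
  have hx' : x'.Compatible :=
    (Presieve.compatible_iff_sieveCompatible x').2 fun W T f k hf => (hx W T f hf k).symm
  obtain ⟨s, hs, hu⟩ := h S hS x' hx'
  exact ⟨s, fun W f hf => hs f hf, fun t ht => hu t fun W f hf => ht W f hf⟩

lemma pull_structurePresheaf_incl {V W : QOpen ρ} (h : V.carrier ≤ W.carrier)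
    (s : Γ(X, W.carrier)) :
    pull (structurePresheaf ρ) (incl h) s = X.presheaf.map (homOfLE h).op s := by
  change (ρ.act 1).appLE _ _ _ s = _
  have : ∀ (φ : X ⟶ X) (_ : φ = 𝟙 X) (e),
      φ.appLE W.carrier V.carrier e s = X.presheaf.map (homOfLE h).op s := by
    rintro _ rfl e
    simp only [Scheme.Hom.appLE, Scheme.Hom.id_app]
    rfl
  exact this _ ρ.act_one _

lemma structurePresheaf_isSheaf : Presheaf.IsSheaf (topology ρ) (structurePresheaf ρ) := by
  apply isSheaf_of_gluing
  intro V S hS x hx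
  let ι := {W : QOpen ρ // ∃ h : W.carrier ≤ V.carrier, S (incl h)}
  have hcov : V.carrier ≤ ⨆ i : ι, i.1.carrier := by
    intro p hp
    obtain ⟨W, f, hf, y, hy, rfl⟩ := hS p hp
    let T : QOpen ρ := ⟨(ρ.act (elt f)⁻¹) ⁻¹ᵁ W.carrier⟩
    have hTV : T.carrier ≤ V.carrier := by
      intro z hz
      have := le_preimage f hz
      change (ρ.act (elt f)) ((ρ.act (elt f)⁻¹) z) ∈ V.carrier at this
      rwa [act_act_inv] at this
    have e : (incl hTV : T ⟶ V) = mkHom (elt f)⁻¹ le_rfl ≫ f := by ext; simp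
    refine TopologicalSpace.Opens.mem_iSup.2
      ⟨⟨T, hTV, by rw [e]; exact S.downward_closed hf _⟩, ?_⟩
    change (ρ.act (elt f)⁻¹) ((ρ.act (elt f)) y) ∈ W.carrier
    rwa [act_inv_act]
  obtain ⟨s, hs, hu⟩ := X.sheaf.existsUnique_gluing' (fun i : ι => i.1.carrier) V.carrier
    (fun i => homOfLE i.2.1) hcov (fun i => x i.1 (incl i.2.1) i.2.2) (by
      intro i j
      let T : QOpen ρ := ⟨i.1.carrier ⊓ j.1.carrier⟩
      have h1 := hx i.1 T (incl i.2.1) i.2.2 (incl inf_le_left)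
      have h2 := hx j.1 T (incl j.2.1) j.2.2 (incl inf_le_right)
      refine ((pull_structurePresheaf_incl inf_le_left _).symm.trans h1).trans (Eq.trans ?_
        (h2.symm.trans (pull_structurePresheaf_incl inf_le_right _)))
      congr 1)
  refine ⟨s, ?_, ?_⟩
  · intro W f hf
    let T : QOpen ρ := ⟨(ρ.act (elt f)⁻¹) ⁻¹ᵁ W.carrier⟩
    have hTV : T.carrier ≤ V.carrier := by
      intro z hz
      have := le_preimage f hz
      change (ρ.act (elt f)) ((ρ.act (elt f)⁻¹) z) ∈ V.carrier at this
      rwa [act_act_inv] at this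
    have e : (incl hTV : T ⟶ V) = mkHom (elt f)⁻¹ le_rfl ≫ f := by ext; simp
    let k : W ⟶ T := mkHom (elt f) (by
      intro z hz
      change (ρ.act (elt f)⁻¹) ((ρ.act (elt f)) z) ∈ W.carrier
      rwa [act_inv_act])
    have e' : k ≫ incl hTV = f := by ext; simp [k]
    have hT : S (incl hTV) := by rw [e]; exact S.downward_closed hf _
    have h1 : pull (structurePresheaf ρ) (incl hTV) s = x T (incl hTV) hT :=
      (pull_structurePresheaf_incl hTV s).trans (hs ⟨T, hTV, hT⟩)
    have h2 := hx T W (incl hTV) hT k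
    have h3 : ∀ (f' : W ⟶ V) (hf' : S f'), f' = k ≫ incl hTV →
        pull (structurePresheaf ρ) f' s = x W f' hf' := by
      rintro _ hf' rfl
      exact (pull_comp (structurePresheaf ρ) k (incl hTV) s).trans ((congrArg _ h1).trans h2)
    exact h3 f hf e'.symm
  · intro t ht
    refine hu t fun i => ?_
    have := ht i.1 (incl i.2.1) i.2.2
    exact (pull_structurePresheaf_incl i.2.1 t).symm.trans this

end Site

section AlternatingSums

variable {B A M : Type*} [AddCommGroup M]

/-- Cancellation in the double alternating sum over faces. -/
lemma altSum_altSum {q : ℕ} (Φ : (Fin q → Fin (q + 2)) → M) :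
    ∑ j : Fin (q + 2), (-1 : ℤ) ^ (j : ℕ) • ∑ i : Fin (q + 1),
      (-1 : ℤ) ^ (i : ℕ) • Φ (j.succAbove ∘ i.succAbove) = 0 := by
  simp only [Finset.smul_sum, smul_smul, ← pow_add]
  rw [← Finset.sum_product' (f := fun (j : Fin (q + 2)) (i : Fin (q + 1)) =>
    (-1 : ℤ) ^ ((j : ℕ) + (i : ℕ)) • Φ (j.succAbove ∘ i.succAbove))]
  refine Finset.sum_involution (fun p _ => (p.1.succAbove p.2, p.2.predAbove p.1)) ?_ ?_ ?_ ?_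
  · rintro ⟨j, i⟩ -
    have h : ((j.succAbove i).succAbove ∘ (i.predAbove j).succAbove : Fin q → Fin (q + 2)) =
        j.succAbove ∘ i.succAbove :=
      funext fun k => Fin.succAbove_succAbove_succAbove_predAbove j i k
    dsimp only
    rw [h, Fin.neg_one_pow_succAbove_add_predAbove, neg_smul, add_neg_cancel]
  · rintro ⟨j, i⟩ - - h
    exact Fin.succAbove_ne j i (congrArg Prod.fst h)
  · intros; simp
  · rintro ⟨j, i⟩ -
    refine Prod.ext (Fin.succAbove_succAbove_predAbove j i) ?_
    apply (Fin.succAbove_right_injective (p := j))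
    have := Fin.succAbove_succAbove_predAbove (j.succAbove i) (i.predAbove j)
    dsimp only at this ⊢
    rwa [Fin.succAbove_succAbove_predAbove j i] at this

lemma altSum_comp_perm {q : ℕ} (Φ : (Fin (q + 1) → B) → M)
    (hΦ : ∀ (σ : Equiv.Perm (Fin (q + 1))) (β : Fin (q + 1) → B),
      Φ (β ∘ σ) = ((Equiv.Perm.sign σ : ℤˣ) : ℤ) • Φ β)
    (σ : Equiv.Perm (Fin (q + 2))) (γ : Fin (q + 2) → B) :
    ∑ j : Fin (q + 2), (-1 : ℤ) ^ (j : ℕ) • Φ ((γ ∘ σ) ∘ j.succAbove) =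
      ((Equiv.Perm.sign σ : ℤˣ) : ℤ) • ∑ j : Fin (q + 2), (-1 : ℤ) ^ (j : ℕ) •
        Φ (γ ∘ j.succAbove) := by
  rw [Finset.smul_sum, ← Equiv.sum_comp σ (fun j : Fin (q + 2) =>
    ((Equiv.Perm.sign σ : ℤˣ) : ℤ) • (-1 : ℤ) ^ (j : ℕ) • Φ (γ ∘ j.succAbove))]
  refine Finset.sum_congr rfl fun j _ => ?_
  let σ' : Equiv.Perm (Fin (q + 2)) := (j.cycleRange.symm.trans σ).trans (σ j).cycleRange
  have h0 : σ' 0 = 0 := by simp [σ']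
  obtain ⟨⟨p, e⟩, he⟩ := Equiv.Perm.decomposeFin.symm.surjective σ'
  have hp : p = 0 := by
    rw [← h0, ← he, Equiv.Perm.decomposeFin_symm_apply_zero]
  subst hp
  have hs : Equiv.Perm.sign σ' = Equiv.Perm.sign e := by
    rw [← he, Equiv.Perm.decomposeFin.symm_sign]; simp
  have hk : ∀ k, σ (j.succAbove k) = (σ j).succAbove (e k) := by
    intro k
    have h1 : σ' k.succ = (e k).succ := by
      rw [← he, Equiv.Perm.decomposeFin_symm_apply_succ]; simp
    have h2 : (σ j).cycleRange (σ (j.succAbove k)) = (e k).succ := by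
      rw [← h1]; simp [σ']
    rw [← Fin.cycleRange_symm_succ (σ j), ← h2, Equiv.symm_apply_apply]
  have hfun : (γ ∘ σ) ∘ j.succAbove = (γ ∘ (σ j).succAbove) ∘ e :=
    funext fun k => congrArg γ (hk k)
  have hsign : Equiv.Perm.sign σ' =
      Equiv.Perm.sign σ * (-1) ^ (j : ℕ) * (-1) ^ ((σ j : Fin (q + 2)) : ℕ) := by
    have : σ' = (σ j).cycleRange * (σ * j.cycleRange.symm) := rfl
    rw [this, Equiv.Perm.sign_mul, Equiv.Perm.sign_mul, Equiv.Perm.sign_symm,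
      Fin.sign_cycleRange, Fin.sign_cycleRange]
    exact mul_comm _ _
  rw [hfun, hΦ, ← hs, hsign, smul_smul, smul_smul]
  congr 1
  push_cast
  have : ((-1 : ℤ) ^ (j : ℕ)) * (-1) ^ (j : ℕ) = 1 := by
    rw [← mul_pow]; simp
  linear_combination (((Equiv.Perm.sign σ : ℤˣ) : ℤ) * (-1) ^ ((σ j : Fin (q + 2)) : ℕ)) * this

lemma altSum_eq_zero {q : ℕ} (Φ : (Fin (q + 1) → B) → M) (α : B → A)
    (hΦ : ∀ (σ : Equiv.Perm (Fin (q + 1))) (β : Fin (q + 1) → B),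
      Φ (β ∘ σ) = ((Equiv.Perm.sign σ : ℤˣ) : ℤ) • Φ β)
    (hΦ' : ∀ β β' : Fin (q + 1) → B, α ∘ β = α ∘ β' → Φ β = Φ β')
    (hΦ0 : ∀ β : Fin (q + 1) → B, ¬ Function.Injective (α ∘ β) → Φ β = 0)
    (γ : Fin (q + 2) → B) (hγ : ¬ Function.Injective (α ∘ γ)) :
    ∑ j : Fin (q + 2), (-1 : ℤ) ^ (j : ℕ) • Φ (γ ∘ j.succAbove) = 0 := by
  have key : ∀ γ : Fin (q + 2) → B, α (γ 0) = α (γ 1) →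
      ∑ j : Fin (q + 2), (-1 : ℤ) ^ (j : ℕ) • Φ (γ ∘ j.succAbove) = 0 := by
    intro γ h01
    rw [Fintype.sum_eq_add (0 : Fin (q + 2)) 1 (by simp)]
    · have : Φ (γ ∘ (0 : Fin (q + 2)).succAbove) = Φ (γ ∘ (1 : Fin (q + 2)).succAbove) := by
        apply hΦ'
        funext k
        cases k using Fin.cases with
        | zero => simpa using h01.symm
        | succ k =>
          simp only [Function.comp_apply, Fin.succAbove_zero]
          rw [← Fin.succ_zero_eq_one, Fin.succ_succAbove_succ, Fin.succAbove_zero]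
      rw [this]; simp
    · rintro k ⟨hk0, hk1⟩
      obtain ⟨i, hi⟩ := Fin.exists_succAbove_eq hk0.symm
      obtain ⟨j, hj⟩ := Fin.exists_succAbove_eq hk1.symm
      rw [hΦ0, smul_zero]
      intro hinj
      have : i = j := hinj (by simpa [hi, hj] using h01)
      subst this
      exact absurd (hi.symm.trans hj) (by simp)
  obtain ⟨i, j, hij, hne⟩ : ∃ i j, α (γ i) = α (γ j) ∧ i ≠ j := by
    simpa [Function.Injective] using hγ
  obtain ⟨σ, h0, h1⟩ : ∃ σ : Equiv.Perm (Fin (q + 2)), σ 0 = i ∧ σ 1 = j := by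
    refine ⟨(Equiv.swap 0 i).trans (Equiv.swap (Equiv.swap 0 i 1) j), ?_, ?_⟩
    · rw [Equiv.trans_apply, Equiv.swap_apply_left]
      refine Equiv.swap_apply_of_ne_of_ne ?_ hne
      intro h
      have := congrArg (Equiv.swap (0 : Fin (q + 2)) i) h
      rw [Equiv.swap_apply_right, Equiv.swap_apply_self] at this
      exact absurd this (by simp)
    · rw [Equiv.trans_apply, Equiv.swap_apply_left]
  have h := altSum_comp_perm Φ hΦ σ γ
  rw [key (γ ∘ σ) (by simpa [h0, h1] using hij)] at h
  rcases Int.units_eq_one_or (Equiv.Perm.sign σ) with hs | hs <;> rw [hs] at h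
  · simpa using h.symm
  · simpa using h.symm

end AlternatingSums

/-- A family of open subsets `U_a` of `X`, indexed by a `G`-set `A`, with `U_{g a} = [g]⁻¹ U_a`. -/
structure EquivariantFamily {G : Type u} [Group G] {X : Scheme.{u}} (ρ : RightAction G X)
    (A : Type u) [MulAction G A] where
  opens : A → X.Opens
  opens_smul : ∀ (g : G) (a : A), opens (g • a) = (ρ.act g) ⁻¹ᵁ (opens a)

section Cech

variable {G : Type u} [Group G] {X : Scheme.{u}} {ρ : RightAction G X}
  {A : Type u} [MulAction G A]

open QOpen

namespace EquivariantFamily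

variable (𝔘 : EquivariantFamily ρ A)

/-- The intersection `U_{α_0} ∩ ⋯ ∩ U_{α_{k-1}}`. -/
def inter {k : ℕ} (α : Fin k → A) : X.Opens := ⨅ i, 𝔘.opens (α i)

lemma mem_inter {k : ℕ} (α : Fin k → A) (x : X) :
    x ∈ 𝔘.inter α ↔ ∀ i, x ∈ 𝔘.opens (α i) := by
  rw [← SetLike.mem_coe, inter, TopologicalSpace.Opens.coe_iInf]
  simp

/-- The open subset `V ∩ U_α` of `X`. -/
def box (V : QOpen ρ) {k : ℕ} (α : Fin k → A) : QOpen ρ := ⟨V.carrier ⊓ 𝔘.inter α⟩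

lemma box_le_comp (V : QOpen ρ) {k l : ℕ} (α : Fin k → A) (β : Fin l → Fin k) :
    (𝔘.box V α).carrier ≤ (𝔘.box V (α ∘ β)).carrier := fun _ hx =>
  ⟨hx.1, (𝔘.mem_inter _ _).2 fun i => (𝔘.mem_inter _ _).1 hx.2 (β i)⟩

lemma box_le (V : QOpen ρ) {k : ℕ} (α : Fin k → A) : (𝔘.box V α).carrier ≤ V.carrier :=
  fun _ hx => hx.1

lemma box_le_preimage {V W : QOpen ρ} (f : V ⟶ W) {k : ℕ} (α : Fin k → A) :
    (𝔘.box V α).carrier ≤ (ρ.act (elt f)) ⁻¹ᵁ (𝔘.box W ((elt f)⁻¹ • α)).carrier := by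
  intro x hx
  refine ⟨le_preimage f hx.1, (𝔘.mem_inter _ _).2 fun i => ?_⟩
  have := (𝔘.mem_inter _ _).1 hx.2 i
  rw [← smul_inv_smul (elt f) (α i), 𝔘.opens_smul] at this
  exact this

/-- For `f : V ⟶ W` with group element `g`, the morphism `V ∩ U_α ⟶ W ∩ U_{g⁻¹ α}` given by `g`. -/
def boxHom {V W : QOpen ρ} (f : V ⟶ W) {k : ℕ} (α : Fin k → A) :
    𝔘.box V α ⟶ 𝔘.box W ((elt f)⁻¹ • α) := mkHom (elt f) (𝔘.box_le_preimage f α)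

@[simp] lemma elt_boxHom {V W : QOpen ρ} (f : V ⟶ W) {k : ℕ} (α : Fin k → A) :
    elt (𝔘.boxHom f α) = elt f := rfl

lemma pull_congr (P : (QOpen ρ)ᵒᵖ ⥤ AddCommGrpCat.{u}) {V T : QOpen ρ} {k : ℕ}
    (s : ∀ α : Fin k → A, P.obj (op (𝔘.box V α))) {α α' : Fin k → A} (h : α = α')
    (f : T ⟶ 𝔘.box V α) (f' : T ⟶ 𝔘.box V α') (hf : elt f = elt f') :
    pull P f (s α) = pull P f' (s α') := by
  subst h
  rw [hom_ext hf]

/-- Alternating cochains over `V`: families `s_α ∈ P(V ∩ U_α)`, indexed by all `(q+1)`-tuples `α` in `A`,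
with `s_{σ(α)} = sgn(σ) s_α` for all permutations `σ`, and `s_α = 0` if two entries of `α` coincide. -/
def cochains (P : (QOpen ρ)ᵒᵖ ⥤ AddCommGrpCat.{u}) (q : ℕ) (V : QOpen ρ) :
    AddSubgroup (∀ α : Fin (q + 1) → A, P.obj (op (𝔘.box V α))) where
  carrier := {s | (∀ (σ : Equiv.Perm (Fin (q + 1))) (α : Fin (q + 1) → A),
      pull P (incl (𝔘.box_le_comp V α σ)) (s (α ∘ σ)) =
        ((Equiv.Perm.sign σ : ℤˣ) : ℤ) • s α) ∧
    ∀ α : Fin (q + 1) → A, ¬ Function.Injective α → s α = 0}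
  zero_mem' := ⟨fun σ α => by simp, fun _ _ => rfl⟩
  add_mem' := fun {s t} hs ht => ⟨fun σ α => by
      rw [Pi.add_apply, Pi.add_apply, map_add, hs.1, ht.1, smul_add],
    fun α hα => by rw [Pi.add_apply, hs.2 α hα, ht.2 α hα, add_zero]⟩
  neg_mem' := fun {s} hs => ⟨fun σ α => by
      rw [Pi.neg_apply, Pi.neg_apply, map_neg, hs.1, smul_neg],
    fun α hα => by rw [Pi.neg_apply, hs.2 α hα, neg_zero]⟩

/-- The equivariant structure on cochains: `s` is mapped to the family `([g]^* s_{g⁻¹ α})_α`. -/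
def cochainsPull (P : (QOpen ρ)ᵒᵖ ⥤ AddCommGrpCat.{u}) (q : ℕ) {V W : QOpen ρ} (f : V ⟶ W) :
    𝔘.cochains P q W →+ 𝔘.cochains P q V where
  toFun s := ⟨fun α => pull P (𝔘.boxHom f α) (s.1 ((elt f)⁻¹ • α)), by
    refine ⟨fun σ α => ?_, fun α hα => ?_⟩
    · rw [← map_zsmul, ← s.2.1, ← pull_comp, ← pull_comp]
      exact 𝔘.pull_congr P s.1 rfl _ _ (by simp)
    · change pull P (𝔘.boxHom f α) (s.1 ((elt f)⁻¹ • α)) = 0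
      rw [s.2.2, map_zero]
      intro h
      exact hα fun i j hij => h (by simp [hij])⟩
  map_zero' := Subtype.ext (funext fun α => map_zero _)
  map_add' s t := Subtype.ext (funext fun α => map_add _ _ _)

/-- The alternating Čech presheaf `∏^alt_α j_{α*} j_α^* P`. -/
def cechPresheaf (P : (QOpen ρ)ᵒᵖ ⥤ AddCommGrpCat.{u}) (q : ℕ) :
    (QOpen ρ)ᵒᵖ ⥤ AddCommGrpCat.{u} where
  obj V := AddCommGrpCat.of (𝔘.cochains P q V.unop)
  map f := AddCommGrpCat.ofHom (𝔘.cochainsPull P q f.unop)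
  map_id V := by
    refine AddCommGrpCat.hom_ext (AddMonoidHom.ext fun s => ?_)
    refine Subtype.ext (funext fun α => ?_)
    change pull P (𝔘.boxHom (𝟙 V.unop) α) (s.1 ((1 : G)⁻¹ • α)) = s.1 α
    exact (𝔘.pull_congr P s.1 (α := (1 : G)⁻¹ • α) (α' := α) (by simp)
      (𝔘.boxHom (𝟙 V.unop) α) (𝟙 _)
      ((𝔘.elt_boxHom _ _).trans ((elt_id _).trans (elt_id _).symm))).trans (pull_id P _ _)
  map_comp {W V T} f h := by
    refine AddCommGrpCat.hom_ext (AddMonoidHom.ext fun s => ?_)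
    refine Subtype.ext (funext fun α => ?_)
    change pull P (𝔘.boxHom (h.unop ≫ f.unop) α) (s.1 ((elt h.unop * elt f.unop)⁻¹ • α)) =
      pull P (𝔘.boxHom h.unop α) (pull P (𝔘.boxHom f.unop ((elt h.unop)⁻¹ • α))
        (s.1 ((elt f.unop)⁻¹ • (elt h.unop)⁻¹ • α)))
    rw [← pull_comp]
    exact 𝔘.pull_congr P s.1 (by
      change (elt h.unop * elt f.unop)⁻¹ • α = _
      rw [mul_inv_rev, mul_smul]) _ _
      ((𝔘.elt_boxHom _ _).trans (elt_comp (𝔘.boxHom h.unop α) (𝔘.boxHom f.unop _)).symm)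

lemma cechPresheaf_pull_apply (P : (QOpen ρ)ᵒᵖ ⥤ AddCommGrpCat.{u}) (q : ℕ) {V W : QOpen ρ}
    (f : V ⟶ W) (s : 𝔘.cochains P q W) (α : Fin (q + 1) → A) :
    (show 𝔘.cochains P q V from pull (𝔘.cechPresheaf P q) f s).1 α =
      pull P (𝔘.boxHom f α) (s.1 ((elt f)⁻¹ • α)) := rfl

lemma cechPresheaf_isSheaf (F : Sheaf (topology ρ) AddCommGrpCat.{u}) (q : ℕ) :
    Presheaf.IsSheaf (topology ρ) (𝔘.cechPresheaf F.obj q) := by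
  apply isSheaf_of_gluing
  intro V S hS x hx
  let x' : ∀ (W : QOpen ρ) (f : W ⟶ V), S f → 𝔘.cochains F.obj q W := fun W f hf => x W f hf
  have hx' : ∀ (W T : QOpen ρ) (f : W ⟶ V) (hf : S f) (k : T ⟶ W) (α : Fin (q + 1) → A),
      pull F.obj (𝔘.boxHom k α) ((x' W f hf).1 ((elt k)⁻¹ • α)) =
        (x' T (k ≫ f) (S.downward_closed hf k)).1 α := fun W T f hf k α =>
    congrArg (fun t : 𝔘.cochains F.obj q T => t.1 α) (hx W T f hf k)
  have hle : ∀ (α : Fin (q + 1) → A) (W : QOpen ρ) (f : W ⟶ 𝔘.box V α),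
      W.carrier ≤ (𝔘.box W (elt f • α)).carrier := by
    intro α W f y hy
    refine ⟨hy, (𝔘.mem_inter _ _).2 fun i => ?_⟩
    rw [Pi.smul_apply, 𝔘.opens_smul]
    exact (𝔘.mem_inter _ _).1 (le_preimage f hy).2 i
  have hcongr : ∀ (T : QOpen ρ) (f f' : T ⟶ V) (_ : f = f') (hf : S f) (hf' : S f')
      (β : Fin (q + 1) → A) (hb : T.carrier ≤ (𝔘.box T β).carrier),
      pull F.obj (incl hb) ((x' T f hf).1 β) = pull F.obj (incl hb) ((x' T f' hf').1 β) := by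
    rintro T f _ rfl hf hf' β hb
    rfl
  have hglue : ∀ α : Fin (q + 1) → A, ∃! s : F.obj.obj (op (𝔘.box V α)),
      ∀ (W : QOpen ρ) (f : W ⟶ 𝔘.box V α) (hf : S (f ≫ incl (𝔘.box_le V α))),
        pull F.obj f s = pull F.obj (incl (hle α W f)) ((x' W _ hf).1 (elt f • α)) := by
    intro α
    refine existsUnique_gluing F (𝔘.box V α) (S.pullback (incl (𝔘.box_le V α)))
      ((topology ρ).pullback_stable _ hS)
      (fun W f hf => pull F.obj (incl (hle α W f)) ((x' W _ hf).1 (elt f • α))) ?_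
    intro W T f hf k
    have h1 := hx' W T _ hf k (elt (k ≫ f) • α)
    have h2 := congrArg (pull F.obj (incl (hle α T (k ≫ f)))) h1
    rw [← pull_comp] at h2
    rw [← pull_comp]
    refine Eq.trans ?_ (h2.trans ?_)
    · exact 𝔘.pull_congr F.obj (x' W _ hf).1 (by simp [mul_smul]) _ _ (by
        change elt k * 1 = 1 * elt k; simp)
    · exact hcongr T _ _ (Category.assoc _ _ _).symm _ _ _ _
  choose s hs hu using hglue
  have huniq : ∀ (α : Fin (q + 1) → A) (a b : F.obj.obj (op (𝔘.box V α))),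
      (∀ (W : QOpen ρ) (f : W ⟶ 𝔘.box V α), S (f ≫ incl (𝔘.box_le V α)) →
        pull F.obj f a = pull F.obj f b) → a = b := by
    intro α a b hab
    obtain ⟨c, -, hc⟩ := existsUnique_gluing F (𝔘.box V α) (S.pullback (incl (𝔘.box_le V α)))
      ((topology ρ).pullback_stable _ hS) (fun W f _ => pull F.obj f a)
      (fun W T f hf k => (pull_comp F.obj k f a).symm)
    rw [hc a fun _ _ _ => rfl, hc b fun W f hf => (hab W f hf).symm]
  have hmem : s ∈ 𝔘.cochains F.obj q V := by
    refine ⟨fun σ α => ?_, fun α hα => ?_⟩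
    · refine huniq α _ _ fun W f hf => ?_
      have e : (f ≫ incl (𝔘.box_le_comp V α σ)) ≫ incl (𝔘.box_le V (α ∘ σ)) =
          f ≫ incl (𝔘.box_le V α) := by ext; simp
      have hf' : S ((f ≫ incl (𝔘.box_le_comp V α σ)) ≫ incl (𝔘.box_le V (α ∘ σ))) := by
        rw [e]; exact hf
      rw [map_zsmul, hs α W f hf, ← map_zsmul, ← (x' W _ hf).2.1, ← pull_comp, ← pull_comp,
        hs (α ∘ σ) W (f ≫ incl (𝔘.box_le_comp V α σ)) hf', hcongr W _ _ e hf' hf]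
      exact 𝔘.pull_congr F.obj (x' W _ hf).1 (by ext; simp) _ _ (mul_one (1 : G)).symm
    · refine huniq α _ _ fun W f hf => ?_
      rw [hs α W f hf, (x' W _ hf).2.2, map_zero, map_zero]
      intro h
      exact hα fun i j hij => h (by simp [hij])
  refine ⟨(⟨s, hmem⟩ : 𝔘.cochains F.obj q V), ?_, ?_⟩
  · intro W f hf
    refine Subtype.ext (funext fun α => ?_)
    change pull F.obj (𝔘.boxHom f α) (s ((elt f)⁻¹ • α)) = (x' W f hf).1 α
    have h1 : S (𝔘.boxHom f α ≫ incl (𝔘.box_le V _)) := by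
      have : 𝔘.boxHom f α ≫ incl (𝔘.box_le V _) = incl (𝔘.box_le W α) ≫ f := by
        ext; simp
      rw [this]; exact S.downward_closed hf _
    rw [hs _ _ _ h1]
    have h2 : ∀ (f' : 𝔘.box W α ⟶ V) (hf' : S f'), f' = incl (𝔘.box_le W α) ≫ f →
        ∀ (β : Fin (q + 1) → A), β = α → ∀ (hb : (𝔘.box W α).carrier ≤
          (𝔘.box (𝔘.box W α) β).carrier),
        pull F.obj (incl hb) ((x' (𝔘.box W α) f' hf').1 β) = (x' W f hf).1 α := by
      rintro _ hf' rfl β rfl hb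
      rw [← hx' W _ f hf (incl (𝔘.box_le W β)) β, ← pull_comp,
        𝔘.pull_congr F.obj (x' W f hf).1 (α := (elt (incl (𝔘.box_le W β)))⁻¹ • β) (α' := β)
          (by simp) (incl hb ≫ 𝔘.boxHom (incl (𝔘.box_le W β)) β) (𝟙 _) (mul_one (1 : G)), pull_id]
    refine h2 _ h1 (by ext; simp) _ (by simp) _
  · intro t ht
    let t' : 𝔘.cochains F.obj q V := t
    refine Subtype.ext (a1 := t') (funext fun α => ?_)
    refine hu α _ fun W f hf => ?_
    have h1 : pull F.obj (𝔘.boxHom (f ≫ incl (𝔘.box_le V α)) (elt f • α))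
        (t'.1 ((elt (f ≫ incl (𝔘.box_le V α)))⁻¹ • elt f • α)) = (x' W _ hf).1 (elt f • α) :=
      congrArg (fun t : 𝔘.cochains F.obj q W => t.1 (elt f • α)) (ht W _ hf)
    rw [← h1, ← pull_comp]
    exact 𝔘.pull_congr F.obj t'.1 (by simp) _ _ (by
      change elt f = 1 * (elt f * 1)
      rw [mul_one, one_mul])

end EquivariantFamily
end Cech

section Complex

variable {G : Type u} [Group G] {X : Scheme.{u}} {ρ : RightAction G X}
  {A : Type u} [MulAction G A]

open QOpen

namespace EquivariantFamily

variable (𝔘 : EquivariantFamily ρ A)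

/-- The Čech differential, the usual alternating sum over the omitted index. -/
def cechDiff (P : (QOpen ρ)ᵒᵖ ⥤ AddCommGrpCat.{u}) (q : ℕ) (V : QOpen ρ) :
    𝔘.cochains P q V →+ 𝔘.cochains P (q + 1) V where
  toFun s := ⟨fun α => ∑ j : Fin (q + 2), (-1 : ℤ) ^ (j : ℕ) •
      pull P (incl (𝔘.box_le_comp V α j.succAbove)) (s.1 (α ∘ j.succAbove)), by
    have hsgn : ∀ (α : Fin (q + 2) → A) (σ : Equiv.Perm (Fin (q + 1)))
        (β : Fin (q + 1) → Fin (q + 2)),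
        pull P (incl (𝔘.box_le_comp V α (β ∘ σ))) (s.1 (α ∘ (β ∘ σ))) =
          ((Equiv.Perm.sign σ : ℤˣ) : ℤ) •
            pull P (incl (𝔘.box_le_comp V α β)) (s.1 (α ∘ β)) := by
      intro α σ β
      rw [← map_zsmul, ← s.2.1, ← pull_comp]
      exact 𝔘.pull_congr P s.1 rfl _ _ (mul_one (1 : G)).symm
    refine ⟨fun σ α => ?_, fun α hα => ?_⟩
    · have h := altSum_comp_perm (B := Fin (q + 2))
        (fun β => pull P (incl (𝔘.box_le_comp V α β)) (s.1 (α ∘ β))) (hsgn α) σ id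
      rw [map_sum]
      refine Eq.trans (Finset.sum_congr rfl fun j _ => ?_) h
      rw [map_zsmul, ← pull_comp]
      congr 1
      exact 𝔘.pull_congr P s.1 rfl _ _ (mul_one (1 : G))
    · exact altSum_eq_zero (B := Fin (q + 2))
        (fun β => pull P (incl (𝔘.box_le_comp V α β)) (s.1 (α ∘ β))) α (hsgn α)
        (fun β β' h => 𝔘.pull_congr P s.1 h _ _
          ((elt_incl _).trans (elt_incl _).symm))
        (fun β h => by rw [s.2.2 _ h, map_zero]) id hα⟩
  map_zero' := Subtype.ext (funext fun α => by
    change ∑ j : Fin (q + 2), (-1 : ℤ) ^ (j : ℕ) •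
      pull P (incl (𝔘.box_le_comp V α j.succAbove)) 0 = 0
    simp)
  map_add' s t := Subtype.ext (funext fun α => by
    change ∑ j : Fin (q + 2), (-1 : ℤ) ^ (j : ℕ) •
        pull P (incl (𝔘.box_le_comp V α j.succAbove))
          (s.1 (α ∘ j.succAbove) + t.1 (α ∘ j.succAbove)) =
      ∑ j : Fin (q + 2), (-1 : ℤ) ^ (j : ℕ) •
        pull P (incl (𝔘.box_le_comp V α j.succAbove)) (s.1 (α ∘ j.succAbove)) +
      ∑ j : Fin (q + 2), (-1 : ℤ) ^ (j : ℕ) •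
        pull P (incl (𝔘.box_le_comp V α j.succAbove)) (t.1 (α ∘ j.succAbove))
    simp only [map_add, smul_add, Finset.sum_add_distrib])

lemma cechDiff_apply (P : (QOpen ρ)ᵒᵖ ⥤ AddCommGrpCat.{u}) (q : ℕ) (V : QOpen ρ)
    (s : 𝔘.cochains P q V) (α : Fin (q + 2) → A) :
    (𝔘.cechDiff P q V s).1 α = ∑ j : Fin (q + 2), (-1 : ℤ) ^ (j : ℕ) •
      pull P (incl (𝔘.box_le_comp V α j.succAbove)) (s.1 (α ∘ j.succAbove)) := rfl

lemma cechDiff_cechDiff (P : (QOpen ρ)ᵒᵖ ⥤ AddCommGrpCat.{u}) (q : ℕ) (V : QOpen ρ)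
    (s : 𝔘.cochains P q V) : 𝔘.cechDiff P (q + 1) V (𝔘.cechDiff P q V s) = 0 := by
  refine Subtype.ext (funext fun α => ?_)
  rw [cechDiff_apply]
  refine Eq.trans (Finset.sum_congr rfl fun j _ => ?_)
    (altSum_altSum fun β => pull P (incl (𝔘.box_le_comp V α β)) (s.1 (α ∘ β)))
  rw [cechDiff_apply, map_sum]
  congr 1
  refine Finset.sum_congr rfl fun i _ => ?_
  rw [map_zsmul, ← pull_comp]
  congr 1
  exact 𝔘.pull_congr P s.1 rfl _ _ (mul_one (1 : G))

lemma cechDiff_naturality (P : (QOpen ρ)ᵒᵖ ⥤ AddCommGrpCat.{u}) (q : ℕ) {V W : QOpen ρ}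
    (f : V ⟶ W) (s : 𝔘.cochains P q W) :
    𝔘.cechDiff P q V (𝔘.cochainsPull P q f s) =
      𝔘.cochainsPull P (q + 1) f (𝔘.cechDiff P q W s) := by
  refine Subtype.ext (funext fun α => ?_)
  change ∑ j : Fin (q + 2), (-1 : ℤ) ^ (j : ℕ) •
      pull P (incl (𝔘.box_le_comp V α j.succAbove)) (pull P (𝔘.boxHom f (α ∘ j.succAbove))
        (s.1 ((elt f)⁻¹ • (α ∘ j.succAbove)))) =
    pull P (𝔘.boxHom f α) (∑ j : Fin (q + 2), (-1 : ℤ) ^ (j : ℕ) •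
      pull P (incl (𝔘.box_le_comp W ((elt f)⁻¹ • α) j.succAbove))
        (s.1 (((elt f)⁻¹ • α) ∘ j.succAbove)))
  rw [map_sum]
  refine Finset.sum_congr rfl fun j _ => ?_
  rw [map_zsmul, ← pull_comp, ← pull_comp]
  congr 1
  exact 𝔘.pull_congr P s.1 rfl _ _ ((one_mul (elt f)).trans (mul_one (elt f)).symm)

/-- The inclusion `P → 𝒞^0`, `s ↦ (s restricted to V ∩ U_a)_a`. -/
def augment (P : (QOpen ρ)ᵒᵖ ⥤ AddCommGrpCat.{u}) (V : QOpen ρ) :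
    P.obj (op V) →+ 𝔘.cochains P 0 V where
  toFun s := ⟨fun α => pull P (incl (𝔘.box_le V α)) s, by
    refine ⟨fun σ α => ?_, fun α hα => ?_⟩
    · have hσ : σ = 1 := Equiv.ext fun i => Subsingleton.elim (α := Fin 1) _ _
      subst hσ
      rw [← pull_comp]
      simp only [Equiv.Perm.sign_one, Units.val_one, one_smul]
      exact congrArg (fun f => pull P f s) (hom_ext (mul_one (1 : G)))
    · exact absurd (fun i j _ => Subsingleton.elim (α := Fin 1) i j) hα⟩
  map_zero' := Subtype.ext (funext fun α => map_zero _)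
  map_add' s t := Subtype.ext (funext fun α => map_add _ _ _)

lemma cechDiff_augment (P : (QOpen ρ)ᵒᵖ ⥤ AddCommGrpCat.{u}) (V : QOpen ρ)
    (s : P.obj (op V)) : 𝔘.cechDiff P 0 V (𝔘.augment P V s) = 0 := by
  refine Subtype.ext (funext fun α => ?_)
  rw [cechDiff_apply]
  have h : ∀ j : Fin 2, pull P (incl (𝔘.box_le_comp V α j.succAbove))
      ((𝔘.augment P V s).1 (α ∘ j.succAbove)) = pull P (incl (𝔘.box_le V α)) s := by
    intro j
    refine (pull_comp P _ _ s).symm.trans ?_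
    exact congrArg (fun f => pull P f s) (hom_ext (mul_one (1 : G)))
  simp [Fin.sum_univ_two, h]

lemma augment_naturality (P : (QOpen ρ)ᵒᵖ ⥤ AddCommGrpCat.{u}) {V W : QOpen ρ}
    (f : V ⟶ W) (s : P.obj (op W)) :
    𝔘.augment P V (pull P f s) = 𝔘.cochainsPull P 0 f (𝔘.augment P W s) := by
  refine Subtype.ext (funext fun α => ?_)
  refine (pull_comp P (incl (𝔘.box_le V α)) f s).symm.trans (Eq.trans ?_
    (pull_comp P (𝔘.boxHom f α) (incl (𝔘.box_le W _)) s))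
  exact congrArg (fun f => pull P f s)
    (hom_ext ((one_mul (elt f)).trans (mul_one (elt f)).symm))

/-- The equivariant sheaf `𝒞^q(𝔘, F) = ∏^alt_{α ∈ A^{q+1}} j_{α*} j_α^* F`. -/
def cechSheaf (F : Sheaf (topology ρ) AddCommGrpCat.{u}) (q : ℕ) :
    Sheaf (topology ρ) AddCommGrpCat.{u} :=
  ⟨𝔘.cechPresheaf F.obj q, 𝔘.cechPresheaf_isSheaf F q⟩

/-- The Čech differential as a morphism of equivariant sheaves. -/
def cechSheafDiff (F : Sheaf (topology ρ) AddCommGrpCat.{u}) (q : ℕ) :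
    𝔘.cechSheaf F q ⟶ 𝔘.cechSheaf F (q + 1) :=
  ⟨{ app := fun V => AddCommGrpCat.ofHom (𝔘.cechDiff F.obj q V.unop)
     naturality := fun _ _ f => AddCommGrpCat.hom_ext (AddMonoidHom.ext fun s =>
      𝔘.cechDiff_naturality F.obj q f.unop s) }⟩

/-- The complex `𝒞^•(𝔘, F)` of equivariant sheaves. -/
def cechComplex (F : Sheaf (topology ρ) AddCommGrpCat.{u}) :
    CochainComplex (Sheaf (topology ρ) AddCommGrpCat.{u}) ℕ :=
  CochainComplex.of (𝔘.cechSheaf F) (𝔘.cechSheafDiff F) fun q => by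
    apply Sheaf.hom_ext
    ext V s
    exact 𝔘.cechDiff_cechDiff F.obj q V.unop s

lemma cechComplex_d (F : Sheaf (topology ρ) AddCommGrpCat.{u}) (q : ℕ) :
    (𝔘.cechComplex F).d q (q + 1) = 𝔘.cechSheafDiff F q := by
  change CochainComplex.of.d (𝔘.cechSheaf F) (𝔘.cechSheafDiff F) q (q + 1) = _
  exact CochainComplex.of_d _ _ q

/-- The augmentation `F → 𝒞^•(𝔘, F)`. -/
noncomputable def cechAugmentation (F : Sheaf (topology ρ) AddCommGrpCat.{u}) :
    (CochainComplex.single₀ (Sheaf (topology ρ) AddCommGrpCat.{u})).obj F ⟶ 𝔘.cechComplex F :=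
  (CochainComplex.fromSingle₀Equiv (𝔘.cechComplex F) F).symm
    ⟨⟨{ app := fun V => AddCommGrpCat.ofHom (𝔘.augment F.obj V.unop)
        naturality := fun _ _ f => AddCommGrpCat.hom_ext (AddMonoidHom.ext fun s =>
          𝔘.augment_naturality F.obj f.unop s) }⟩, by
      rw [show (𝔘.cechComplex F).d 0 1 = 𝔘.cechSheafDiff F 0 from 𝔘.cechComplex_d F 0]
      apply Sheaf.hom_ext
      ext V s
      exact 𝔘.cechDiff_augment F.obj V.unop s⟩

end EquivariantFamily

variable (ρ) in
/-- The open set `X` itself. -/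
def whole : QOpen ρ := ⟨⊤⟩

variable (ρ) in
/-- The endomorphism of `X` given by `g`. -/
def translate (g : G) : whole ρ ⟶ whole ρ := mkHom g le_top

/-- The `G`-invariant global sections. -/
def invariants (P : (QOpen ρ)ᵒᵖ ⥤ AddCommGrpCat.{u}) : AddSubgroup (P.obj (op (whole ρ))) where
  carrier := {s | ∀ g : G, pull P (translate ρ g) s = s}
  zero_mem' g := map_zero _
  add_mem' hs ht g := by rw [map_add, hs g, ht g]
  neg_mem' hs g := by rw [map_neg, hs g]

variable (ρ) in
/-- The functor of equivariant global sections `Γ(X/G, F) = Γ(X, F)^G`. -/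
def equivariantSections : Sheaf (topology ρ) AddCommGrpCat.{u} ⥤ AddCommGrpCat.{u} where
  obj F := AddCommGrpCat.of (invariants F.obj)
  map {F F'} φ := AddCommGrpCat.ofHom
    (((φ.hom.app (op (whole ρ))).hom.comp (invariants F.obj).subtype).codRestrict
      (invariants F'.obj) fun s g => by
        have h := congrArg (fun ψ : F.obj.obj (op (whole ρ)) ⟶ F'.obj.obj (op (whole ρ)) =>
          ψ.hom s.1) (φ.hom.naturality (translate ρ g).op)
        exact h.symm.trans (congrArg (φ.hom.app (op (whole ρ))).hom (s.2 g)))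
  map_id F := rfl
  map_comp φ ψ := rfl

instance : (equivariantSections ρ).Additive where
  map_add := rfl

variable (ρ) in
/-- Equivariant cohomology `H^m(X/G, F)`: the `m`-th right derived functor of `Γ(X/G, -)`. -/
noncomputable def equivariantCohomology (m : ℕ) (F : Sheaf (topology ρ) AddCommGrpCat.{u}) :
    AddCommGrpCat.{u} :=
  ((equivariantSections ρ).rightDerived m).obj F

variable (ρ) in
/-- The structure sheaf `𝒪_X` with its natural equivariant structure. -/
def structureSheaf : Sheaf (topology ρ) AddCommGrpCat.{u} :=
  ⟨structurePresheaf ρ, structurePresheaf_isSheaf⟩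

namespace EquivariantFamily

variable (𝔘 : EquivariantFamily ρ A)

/-- The complex `C^•(𝔘/G, F) = Γ(X/G, 𝒞^•(𝔘, F))`. -/
noncomputable def equivariantCechComplex (F : Sheaf (topology ρ) AddCommGrpCat.{u}) :
    CochainComplex AddCommGrpCat.{u} ℕ :=
  ((equivariantSections ρ).mapHomologicalComplex (ComplexShape.up ℕ)).obj (𝔘.cechComplex F)

/-- The component `z_α ∈ F(X ∩ U_α)` of an equivariant cochain `z ∈ C^q(𝔘/G, F)`. -/
def component (F : Sheaf (topology ρ) AddCommGrpCat.{u}) {q : ℕ}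
    (z : (𝔘.equivariantCechComplex F).X q) (α : Fin (q + 1) → A) :
    F.obj.obj (op (𝔘.box (whole ρ) α)) :=
  (show 𝔘.cochains F.obj q (whole ρ) from
    (show invariants (𝔘.cechPresheaf F.obj q) from z).1).1 α

/-- `c ∈ H^m(X/G, F)` is the class of the cochain `z ∈ C^m(𝔘/G, F)`: `z` is a cocycle `ζ`, and for some
injective resolution `F → I^•` and some morphism of complexes `φ : 𝒞^•(𝔘, F) → I^•` under `F`, the
map `H^m(C^•(𝔘/G, F)) → H^m(Γ(X/G, I^•)) = H^m(X/G, F)` induced by `φ` sends the class of `ζ` to `c`. -/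
def IsClassOf (F : Sheaf (topology ρ) AddCommGrpCat.{u}) {m : ℕ}
    (z : (𝔘.equivariantCechComplex F).X m) (c : equivariantCohomology ρ m F) : Prop :=
  ∃ (ζ : (𝔘.equivariantCechComplex F).cycles m)
    (I : InjectiveResolution F) (φ : 𝔘.cechComplex F ⟶ I.cocomplex),
    ((𝔘.equivariantCechComplex F).iCycles m).hom ζ = z ∧
    𝔘.cechAugmentation F ≫ φ = I.ι ∧
    (I.isoRightDerivedObj (equivariantSections ρ) m).hom.hom c =
      (HomologicalComplex.homologyMap
        (((equivariantSections ρ).mapHomologicalComplex (ComplexShape.up ℕ)).map φ) m).hom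
        (((𝔘.equivariantCechComplex F).homologyπ m).hom ζ)

end EquivariantFamily
end Complex

open NumberField Module

section Arithmetic

variable {F : Type u} [Field F]

/-- Total positivity: positivity under all real embeddings. -/
def IsTotPos (x : F) : Prop := ∀ φ : F →+* ℝ, 0 < φ x

lemma IsTotPos.mul {x y : F} (hx : IsTotPos x) (hy : IsTotPos y) : IsTotPos (x * y) :=
  fun φ => by rw [map_mul]; exact mul_pos (hx φ) (hy φ)

variable (F) in
/-- The group `Δ` of totally positive units. -/
def totPosUnits : Subgroup (𝓞 F)ˣ where
  carrier := {ε | IsTotPos ((ε : 𝓞 F) : F)}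
  one_mem' φ := by simp
  mul_mem' ha hb := by simpa using ha.mul hb
  inv_mem' := by
    intro ε h φ
    have h1 : φ ((ε : 𝓞 F) : F) * φ (((ε⁻¹ : (𝓞 F)ˣ) : 𝓞 F) : F) = 1 := by
      rw [← map_mul, ← map_mul (algebraMap (𝓞 F) F), Units.mul_inv, map_one, map_one]
    exact pos_of_mul_pos_right (h1 ▸ one_pos) (h φ).le

variable (F) in
/-- The set `A` of primitive totally positive integers: the totally positive `α` such that `α / N` is not
a totally positive integer for any integer `N > 1`. -/
def primitives : Set (𝓞 F) :=
  {α : 𝓞 F | IsTotPos (α : F) ∧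
    ∀ N : ℕ, 1 < N → ¬ ∃ β : 𝓞 F, IsTotPos (β : F) ∧ (β : F) = (α : F) / (N : F)}

/-- `Δ` acts on `A` by multiplication. -/
instance : MulAction (totPosUnits F) (primitives F) where
  smul ε α := ⟨((ε : (𝓞 F)ˣ) : 𝓞 F) * α.1, by
    refine ⟨by simpa using ε.2.mul α.2.1, ?_⟩
    rintro N hN ⟨β, hβ, h⟩
    refine α.2.2 N hN ⟨(((ε⁻¹ : totPosUnits F) : (𝓞 F)ˣ) : 𝓞 F) * β, ?_, ?_⟩
    · simpa using (ε⁻¹).2.mul hβ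
    · have h1 : (((ε : (𝓞 F)ˣ)⁻¹ : (𝓞 F)ˣ) : 𝓞 F) * ((ε : (𝓞 F)ˣ) : 𝓞 F) = 1 :=
        Units.inv_mul _
      have h2 := congrArg (algebraMap (𝓞 F) F) h1
      rw [map_mul, map_one] at h2
      change algebraMap (𝓞 F) F ((((ε : (𝓞 F)ˣ)⁻¹ : (𝓞 F)ˣ) : 𝓞 F) * β) = _
      have h' : algebraMap (𝓞 F) F β =
          algebraMap (𝓞 F) F (((ε : (𝓞 F)ˣ) : 𝓞 F) * α.1) / (N : F) := h
      rw [map_mul (algebraMap (𝓞 F) F), h', map_mul (algebraMap (𝓞 F) F)]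
      rw [mul_div_assoc, ← mul_assoc, h2, one_mul]⟩
  one_smul α := Subtype.ext (one_mul α.1)
  mul_smul ε δ α := Subtype.ext (mul_assoc ((ε : (𝓞 F)ˣ) : 𝓞 F) ((δ : (𝓞 F)ˣ) : 𝓞 F) α.1)

lemma primitives_smul_val (ε : totPosUnits F) (α : primitives F) :
    (ε • α).1 = ((ε : (𝓞 F)ˣ) : 𝓞 F) * α.1 := rfl

variable (F) in
/-- The group ring `ℤ[t^α | α ∈ 𝓞 F]`, with `t^α t^β = t^{α + β}`. -/
abbrev CoordRing : Type u := AddMonoidAlgebra ℤ (𝓞 F)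

/-- The element `t^α`. -/
noncomputable def monom (α : 𝓞 F) : CoordRing F := AddMonoidAlgebra.single α 1

variable (F) in
/-- The torus `𝕋 = Hom(𝓞 F, 𝔾_m) = Spec ℤ[t^α | α ∈ 𝓞 F]`. -/
noncomputable abbrev torus : Scheme.{u} := Spec (CommRingCat.of (CoordRing F))

/-- The automorphism `t^α ↦ t^{εα}` of the coordinate ring. -/
noncomputable def actRing (ε : totPosUnits F) : CoordRing F →+* CoordRing F :=
  AddMonoidAlgebra.mapDomainRingHom ℤ (AddMonoidHom.mulLeft ((ε : (𝓞 F)ˣ) : 𝓞 F))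

lemma actRing_monom (ε : totPosUnits F) (α : 𝓞 F) :
    actRing ε (monom α) = monom (((ε : (𝓞 F)ˣ) : 𝓞 F) * α) := by
  simp [actRing, monom]

lemma ringHom_ext_monom {R : Type*} [CommRing R] {f g : CoordRing F →+* R}
    (h : ∀ α, f (monom α) = g (monom α)) : f = g :=
  AddMonoidAlgebra.ringHom_ext' (Subsingleton.elim _ _) (MonoidHom.ext fun α => h α.toAdd)

lemma actRing_one : actRing (1 : totPosUnits F) = RingHom.id _ :=
  ringHom_ext_monom fun α => by simp [actRing_monom]

lemma actRing_mul (ε δ : totPosUnits F) : actRing (ε * δ) = (actRing ε).comp (actRing δ) :=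
  ringHom_ext_monom fun α => by simp [actRing_monom, mul_assoc]

variable (F) in
/-- The right action of `Δ` on `𝕋`, with `[ε]` given by `t^α ↦ t^{εα}`. -/
noncomputable def torusAction : RightAction (totPosUnits F) (torus F) where
  act ε := Spec.map (CommRingCat.ofHom (actRing ε))
  act_one := by rw [actRing_one]; exact Spec.map_id _
  act_mul ε δ := by
    rw [← Spec.map_comp, actRing_mul]; rfl

variable (F) in
/-- The homomorphism `t^α ↦ 1` to `ℤ`, which defines the identity section `1` of `𝕋`. -/
noncomputable def counit : CoordRing F →+* ℤ :=
  (AddMonoidAlgebra.lift ℤ ℤ (𝓞 F) (1 : Multiplicative (𝓞 F) →* ℤ)).toRingHom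

lemma counit_monom (α : 𝓞 F) : counit F (monom α) = 1 := by
  simp [counit, monom]

lemma counit_comp_actRing (ε : totPosUnits F) : (counit F).comp (actRing ε) = counit F :=
  ringHom_ext_monom fun α => by simp [actRing_monom, counit_monom]

variable (F) in
/-- The open subset `U = 𝕋 ∖ {1}`, the complement of the image of the identity section. -/
noncomputable def puncturedTorus : (torus F).Opens :=
  ⟨(Set.range (PrimeSpectrum.comap (counit F)))ᶜ, by
    rw [isOpen_compl_iff]
    exact PrimeSpectrum.isClosed_range_comap_of_surjective _ _ fun n => ⟨n, by simp⟩⟩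

lemma puncturedTorus_le_preimage (ε : totPosUnits F) :
    puncturedTorus F ≤ (torusAction F).act ε ⁻¹ᵁ puncturedTorus F := by
  rintro x hx ⟨p, hp⟩
  refine hx ⟨p, ?_⟩
  have h1 := act_inv_act (torusAction F) ε x
  rw [← h1]
  change _ = PrimeSpectrum.comap (actRing ε⁻¹) (((torusAction F).act ε) x)
  rw [← (show _ = ((torusAction F).act ε) x from hp), ← PrimeSpectrum.comap_comp_apply,
    counit_comp_actRing]

variable (F) in
/-- The action of `Δ` on the open subscheme `U`. -/
noncomputable def puncturedAction :
    RightAction (totPosUnits F) (puncturedTorus F).toScheme where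
  act ε := ((torusAction F).act ε).resLE _ _ (puncturedTorus_le_preimage ε)
  act_one := by
    rw [← cancel_mono (puncturedTorus F).ι, Scheme.Hom.resLE_comp_ι, (torusAction F).act_one,
      Category.comp_id, Category.id_comp]
  act_mul ε δ := by
    rw [← cancel_mono (puncturedTorus F).ι]
    simp [Scheme.Hom.resLE_comp_ι, (torusAction F).act_mul]

/-- The open subset `U_α = 𝕋 ∖ {t^α = 1}`. -/
noncomputable def torusOpen (α : 𝓞 F) : (torus F).Opens :=
  PrimeSpectrum.basicOpen (1 - monom α)

lemma torusOpen_mul (ε : totPosUnits F) (α : 𝓞 F) :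
    torusOpen (((ε : (𝓞 F)ˣ) : 𝓞 F) * α) = (torusAction F).act ε ⁻¹ᵁ torusOpen α := by
  have h := PrimeSpectrum.comap_basicOpen (actRing ε) (1 - monom α)
  rw [map_sub, map_one, actRing_monom] at h
  exact h.symm

variable (F) in
/-- The family `𝔘 = (U_α)_{α ∈ A}` of open subsets of `U`. -/
noncomputable def standardCover : EquivariantFamily (puncturedAction F) (primitives F) where
  opens α := (puncturedTorus F).ι ⁻¹ᵁ torusOpen α.1
  opens_smul ε α := by
    rw [primitives_smul_val, torusOpen_mul, ← Scheme.Hom.comp_preimage,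
      ← Scheme.Hom.comp_preimage]
    exact congrArg (fun f : (puncturedTorus F).toScheme ⟶ torus F => f ⁻¹ᵁ torusOpen α.1)
      (Scheme.Hom.resLE_comp_ι ..).symm

variable {n : ℕ} (τ : Fin (n + 1) ≃ (F →+* ℝ))

/-- The vector `(x^{τ_1}, …, x^{τ_g})`, where `g = n + 1`. -/
def embed (x : F) : Fin (n + 1) → ℝ := fun i => τ i x

/-- The parallelepiped `P_α = {x_1 α_1 + ⋯ + x_g α_g | 0 ≤ x_i < 1}` in `ℝ^I`. -/
def parallelepiped (α : Fin (n + 1) → primitives F) : Set (Fin (n + 1) → ℝ) :=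
  {u | ∃ x : Fin (n + 1) → ℝ, (∀ i, 0 ≤ x i ∧ x i < 1) ∧
    u = ∑ i, x i • embed τ ((α i).1 : F)}

/-- The set of all `u` with positive coordinates such that, for some `δ > 0`, the points
`(u_1, …, u_{g-1}, u_g - δ')` with `0 < δ' < δ` all lie in `R`. -/
def upperClosure (R : Set (Fin (n + 1) → ℝ)) : Set (Fin (n + 1) → ℝ) :=
  {u | (∀ i, 0 < u i) ∧ ∃ δ > 0, ∀ δ', 0 < δ' → δ' < δ → u - Pi.single (Fin.last n) δ' ∈ R}

/-- The totally positive integers whose vector lies in the upper closure of `P_α`. -/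
def latticePoints (α : Fin (n + 1) → primitives F) : Set (𝓞 F) :=
  {β | embed τ (β : F) ∈ upperClosure (parallelepiped τ α)}

lemma finite_latticePoints [NumberField F] [IsTotallyReal F]
    (α : Fin (n + 1) → primitives F) : (latticePoints τ α).Finite := by
  have key : ∀ β ∈ latticePoints τ α, ∀ i, |τ i (β : F)| ≤ ∑ k, ∑ j, τ k ((α j).1 : F) + 1 := by
    rintro β ⟨hpos, δ, hδ, h⟩ i
    obtain ⟨x, hx, hxu⟩ := h (min (δ / 2) 1) (by positivity)
      ((min_le_left _ _).trans_lt (by linarith))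
    have hi := congrFun hxu i
    simp only [Pi.sub_apply, Finset.sum_apply, Pi.smul_apply, smul_eq_mul, embed] at hi
    rw [abs_of_pos (show 0 < τ i (β : F) from hpos i)]
    have h1 : (Pi.single (Fin.last n) (min (δ / 2) 1) : Fin (n + 1) → ℝ) i ≤ 1 := by
      rw [Pi.single_apply]; split_ifs
      · exact min_le_right _ _
      · exact zero_le_one
    have h2 : ∑ j, x j * τ i ((α j).1 : F) ≤ ∑ j, τ i ((α j).1 : F) :=
      Finset.sum_le_sum fun j _ =>
        mul_le_of_le_one_left ((α j).2.1 (τ i)).le (hx j).2.le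
    have h3 : ∑ j, τ i ((α j).1 : F) ≤ ∑ k, ∑ j, τ k ((α j).1 : F) :=
      Finset.single_le_sum (f := fun k => ∑ j, τ k ((α j).1 : F))
        (fun k _ => Finset.sum_nonneg fun j _ => ((α j).2.1 (τ k)).le) (Finset.mem_univ i)
    linarith
  have hfin := Embeddings.finite_of_norm_le F ℂ (∑ k, ∑ j, τ k ((α j).1 : F) + 1)
  refine (hfin.preimage (f := fun β : 𝓞 F => (β : F))
    (RingOfIntegers.coe_injective.injOn)).subset fun β hβ => ⟨RingOfIntegers.isIntegral_coe β, ?_⟩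
  intro φ
  have hφ : ComplexEmbedding.IsReal φ := by
    have h := IsTotallyReal.isReal (InfinitePlace.mk φ)
    exact InfinitePlace.isReal_mk_iff.1 h
  have h := key β hβ (τ.symm hφ.embedding)
  rw [Equiv.apply_symm_apply] at h
  rw [← hφ.coe_embedding_apply, Complex.norm_real]
  exact h

/-- The sign of `det (α_j^{τ_i})`. -/
noncomputable def sgn (α : Fin (n + 1) → primitives F) : ℤ :=
  (SignType.sign (Matrix.det (Matrix.of fun i j => τ i ((α j).1 : F))) : SignType)

/-- The open subset `U_{α_1} ∩ ⋯ ∩ U_{α_g}` of `𝕋`. -/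
noncomputable def torusInter (α : Fin (n + 1) → primitives F) : (torus F).Opens :=
  ⨅ i, torusOpen (α i).1

/-- An element of the coordinate ring as a function on the open subset `V` of `𝕋`. -/
noncomputable def toSections (V : (torus F).Opens) : CoordRing F →+* Γ(torus F, V) :=
  ((Scheme.ΓSpecIso (CommRingCat.of (CoordRing F))).inv ≫
    (torus F).presheaf.map (homOfLE le_top).op).hom

lemma isUnit_denominator (α : Fin (n + 1) → primitives F) :
    IsUnit (toSections (torusInter α) (∏ i, (1 - monom (α i).1))) := by
  rw [map_prod, IsUnit.prod_univ_iff]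
  intro i
  have hle : torusInter α ≤
      (torus F).basicOpen ((Scheme.ΓSpecIso (CommRingCat.of (CoordRing F))).inv
        (1 - monom (α i).1)) := by
    rw [basicOpen_eq_of_affine]
    exact iInf_le _ i
  have h := ((torus F).toRingedSpace.isUnit_res_basicOpen
    ((Scheme.ΓSpecIso (CommRingCat.of (CoordRing F))).inv (1 - monom (α i).1))).map
    ((torus F).presheaf.map (homOfLE hle).op).hom
  convert! h using 1

/-- The rational function `(∑ t^β) / ((1 - t^{α_1}) ⋯ (1 - t^{α_g}))` in `Γ(U_α, 𝒪_𝕋)`, where `β` runs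
through the integers in the upper closure of `P_α`. -/
noncomputable def shintaniFunction [NumberField F] [IsTotallyReal F]
    (α : Fin (n + 1) → primitives F) : Γ(torus F, torusInter α) :=
  toSections (torusInter α) (∑ β ∈ (finite_latticePoints τ α).toFinset, monom β) *
    ((isUnit_denominator α).unit⁻¹ : (Γ(torus F, torusInter α))ˣ)

end Arithmetic

open NumberField


lemma box_le_torusInter {F : Type u} [Field F] {n : ℕ} (α : Fin (n + 1) → primitives F) :
    ((standardCover F).box (whole (puncturedAction F)) α).carrier ≤
      (puncturedTorus F).ι ⁻¹ᵁ torusInter α := by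
  intro x hx
  have h := ((standardCover F).mem_inter α x).1 hx.2
  change (puncturedTorus F).ι x ∈ torusInter α
  rw [← SetLike.mem_coe, torusInter, TopologicalSpace.Opens.coe_iInf]
  exact Set.mem_iInter.2 h

section Cocycle

variable {F : Type u} [Field F] [NumberField F] [IsTotallyReal F] {n : ℕ}

/-- The function `sgn(α) 𝒢_{σ_α}` in `Γ(U_α, 𝒪_𝕋)`. -/
noncomputable def signedShintani (τ : Fin (n + 1) ≃ (F →+* ℝ)) (α : Fin (n + 1) → primitives F) :
    Γ(torus F, torusInter α) :=
  sgn τ α • shintaniFunction τ α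

/-- The function `sgn(α) 𝒢_{σ_α}` as a section of `𝒪_U` over the open subset `U_α` of `U`. -/
noncomputable def shintaniComponent (τ : Fin (n + 1) ≃ (F →+* ℝ))
    (α : Fin (n + 1) → primitives F) :
    (structureSheaf (puncturedAction F)).obj.obj
      (op ((standardCover F).box (whole (puncturedAction F)) α)) :=
  ((puncturedTorus F).ι.appLE (torusInter α)
    ((standardCover F).box (whole (puncturedAction F)) α).carrier
    (box_le_torusInter α)).hom (signedShintani τ α)

end Cocycle

end Shintani

/-! Expanded formally, `𝒢_{σ_α}` is the generating series of the integers lying in the cone spanned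
by the `α_j` after an infinitesimal displacement in the direction `-e_g`. The cocycle condition
therefore rests on a relation between cones: for `g + 1` elements of `A`, the signed indicator
functions of the cones on `g` of them cancel (`sum_sgn_inCone_eq_zero`).

For vectors in an open half-space and a point `v` in general position, this is a statement about a
line. If the maximal minors do not all vanish, then, taken with alternating signs, they form a
linear relation `c` between the vectors; the representations of `v` form a line `p - t c`; and, when
`c j ≠ 0`, `v` lies in the cone omitting `j` iff the point of the line with vanishing `j`-th
coordinate lies in the closed orthant. As `c` has entries of both signs, the line crosses the
orthant either not at all or by one entry and one exit, which carry opposite signs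
(`sum_sign_orthant_eq_zero`). Displaced integers are in general position because the inverse of
`(α_j^{τ_i})` has no zero entry: its entries are conjugates of the elements of the trace-dual basis
(`embedMatrix_inv_ne_zero`).

Convergence plays no role. The group ring acts by translations on arbitrary functions `𝓞 F → ℤ`, and
`∏ (1 - t^{α_k})` truncates the indicator of a cone to that of the half-open parallelepiped, which
is the numerator (`coeff_numerator_eq_shift`). Applying the product over all `g + 1` factors to the
relation between cones gives an identity in the group ring (`sum_sgn_numerator_eq_zero`), and the
denominators are units on `U_α`. Alternation comes from the sign of the determinant; invariance
holds because a totally positive unit acts on `ℝ^g` by a positive diagonal matrix.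

For the class, the `U_α` cover `U`: the exponents `β` with `t^β = 1` at a point form a subgroup, and
`A` generates `𝓞 F` (`exists_mem_standardCover_opens`). Hence the augmented Čech complex is a
resolution, contractible over each `U_a` (`isResolution_cech`). It maps to any injective resolution,
uniquely up to homotopy, so a cocycle has exactly one class (`existsUnique_isClassOf`). No
acyclicity of the Čech sheaves is needed. -/

namespace Shintani

open CategoryTheory Limits

universe w' w

/-! ### Comparison of a resolution with injective resolutions. -/

section ResolutionComparison

variable {C : Type w} [Category.{w'} C] [Abelian C]

/-- An augmented cochain complex `0 → Z → K⁰ → K¹ → ⋯` that is exact. -/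
structure IsResolution {Z : C} {K : CochainComplex C ℕ}
    (a : (CochainComplex.single₀ C).obj Z ⟶ K) : Prop where
  mono : Mono (a.f 0)
  comp_d : a.f 0 ≫ K.d 0 1 = 0
  exact₀ : (ShortComplex.mk (a.f 0) (K.d 0 1) comp_d).Exact
  exact_succ : ∀ n, (ShortComplex.mk _ _ (K.d_comp_d n (n + 1) (n + 2))).Exact

namespace IsResolution

variable {Z : C} {K : CochainComplex C ℕ} {a : (CochainComplex.single₀ C).obj Z ⟶ K}

/-- A resolution of `Z` maps to every injective resolution of `Z`, compatibly with augmentations. -/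
lemma exists_desc (h : IsResolution a) (I : InjectiveResolution Z) :
    ∃ φ : K ⟶ I.cocomplex, a ≫ φ = I.ι := by
  have := h.mono
  let f₀ : K.X 0 ⟶ I.cocomplex.X 0 := Injective.factorThru (I.ι.f 0) (a.f 0)
  have h₀ : a.f 0 ≫ f₀ = I.ι.f 0 := Injective.comp_factorThru _ _
  have w₀ : a.f 0 ≫ f₀ ≫ I.cocomplex.d 0 1 = 0 := by
    rw [reassoc_of% h₀]
    exact I.ι_f_zero_comp_complex_d
  let f₁ : K.X 1 ⟶ I.cocomplex.X 1 := h.exact₀.descToInjective (f₀ ≫ I.cocomplex.d 0 1) w₀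
  have h₁ : K.d 0 1 ≫ f₁ = f₀ ≫ I.cocomplex.d 0 1 := h.exact₀.comp_descToInjective _ _
  have hs : ∀ (n : ℕ) (g : K.X n ⟶ I.cocomplex.X n)
      (g' : K.X (n + 1) ⟶ I.cocomplex.X (n + 1))
      (_ : g ≫ I.cocomplex.d n (n + 1) = K.d n (n + 1) ≫ g'),
      ∃ g'' : K.X (n + 2) ⟶ I.cocomplex.X (n + 2),
        g' ≫ I.cocomplex.d (n + 1) (n + 2) = K.d (n + 1) (n + 2) ≫ g'' := by
    intro n g g' w
    refine ⟨(h.exact_succ n).descToInjective (g' ≫ I.cocomplex.d (n + 1) (n + 2)) ?_,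
      ((h.exact_succ n).comp_descToInjective _ _).symm⟩
    change K.d n (n + 1) ≫ g' ≫ I.cocomplex.d (n + 1) (n + 2) = 0
    rw [← reassoc_of% w, HomologicalComplex.d_comp_d, comp_zero]
  refine ⟨CochainComplex.mkHom _ _ f₀ f₁ h₁.symm fun n p =>
    ⟨(hs n p.1 p.2.1 p.2.2).choose, (hs n p.1 p.2.1 p.2.2).choose_spec⟩, ?_⟩
  apply HomologicalComplex.from_single_hom_ext
  simpa using h₀

/-- A morphism from a resolution to an injective resolution that kills the augmentation is
null-homotopic. -/
lemma nonempty_homotopy_zero (h : IsResolution a) {Y : C} (I : InjectiveResolution Y)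
    (f : K ⟶ I.cocomplex) (hf : a.f 0 ≫ f.f 0 = 0) : Nonempty (Homotopy f 0) := by
  let s₀ : K.X 1 ⟶ I.cocomplex.X 0 := h.exact₀.descToInjective (f.f 0) hf
  have h₀ : K.d 0 1 ≫ s₀ = f.f 0 := h.exact₀.comp_descToInjective _ _
  have w₁ : K.d 0 1 ≫ (f.f 1 - s₀ ≫ I.cocomplex.d 0 1) = 0 := by
    rw [Preadditive.comp_sub, reassoc_of% h₀, HomologicalComplex.Hom.comm, sub_self]
  let s₁ : K.X 2 ⟶ I.cocomplex.X 1 := (h.exact_succ 0).descToInjective _ w₁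
  have h₁ : K.d 1 2 ≫ s₁ = f.f 1 - s₀ ≫ I.cocomplex.d 0 1 :=
    (h.exact_succ 0).comp_descToInjective _ _
  have hs : ∀ (n : ℕ) (g : K.X (n + 1) ⟶ I.cocomplex.X n)
      (g' : K.X (n + 2) ⟶ I.cocomplex.X (n + 1))
      (_ : f.f (n + 1) = g ≫ I.cocomplex.d n (n + 1) + K.d (n + 1) (n + 2) ≫ g'),
      ∃ g'' : K.X (n + 3) ⟶ I.cocomplex.X (n + 2),
        f.f (n + 2) = g' ≫ I.cocomplex.d (n + 1) (n + 2) + K.d (n + 2) (n + 3) ≫ g'' := by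
    intro n g g' w
    have h2 : K.d (n + 1) (n + 2) ≫ (f.f (n + 2) - g' ≫ I.cocomplex.d _ _) = 0 := by
      rw [Preadditive.comp_sub, ← HomologicalComplex.Hom.comm, w, Preadditive.add_comp,
        Category.assoc, Category.assoc, HomologicalComplex.d_comp_d, comp_zero, zero_add, sub_self]
    have h3 := (h.exact_succ (n + 1)).comp_descToInjective _ h2
    refine ⟨(h.exact_succ (n + 1)).descToInjective _ h2, ?_⟩
    rw [← sub_eq_iff_eq_add']
    exact h3.symm
  exact ⟨Homotopy.mkCoinductive _ s₀ h₀.symm s₁ (by rw [h₁]; abel) fun n p =>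
    ⟨(hs n p.1 p.2.1 p.2.2).choose, (hs n p.1 p.2.1 p.2.2).choose_spec⟩⟩

/-- Two maps from a resolution to an injective resolution that agree on the augmentation are
homotopic. -/
lemma nonempty_homotopy (h : IsResolution a) {Y : C} (I : InjectiveResolution Y)
    (f f' : K ⟶ I.cocomplex) (hf : a ≫ f = a ≫ f') : Nonempty (Homotopy f f') := by
  obtain ⟨s⟩ := h.nonempty_homotopy_zero I (f - f') (by
    have := HomologicalComplex.congr_hom hf 0
    rw [HomologicalComplex.sub_f_apply, Preadditive.comp_sub, sub_eq_zero]
    exact this)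
  exact ⟨Homotopy.equivSubZero.symm s⟩

end IsResolution

end ResolutionComparison

open AlgebraicGeometry Opposite QOpen

universe u

/-! ### The Čech resolution and the class of a Čech cocycle. -/

section CechClass

variable {G : Type u} [Group G] {X : Scheme.{u}} {ρ : RightAction G X}
  {A : Type u} [MulAction G A]

namespace EquivariantFamily

variable (𝔘 : EquivariantFamily ρ A)

/-- A permutation of `{1, …, q+1}`, extended to `{0, …, q+1}` by fixing `0`. -/
lemma exists_perm_cons {q : ℕ} (σ : Equiv.Perm (Fin (q + 1))) :
    ∃ σ' : Equiv.Perm (Fin (q + 2)), Equiv.Perm.sign σ' = Equiv.Perm.sign σ ∧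
      ∀ (a : A) (α : Fin (q + 1) → A),
        (Fin.cons a α : Fin (q + 2) → A) ∘ σ' = Fin.cons a (α ∘ σ) := by
  refine ⟨Equiv.Perm.decomposeFin.symm (0, σ), by simp, fun a α => funext fun k => ?_⟩
  cases k using Fin.cases with
  | zero => simp
  | succ k => simp

lemma cons_comp_succAbove_succ {q : ℕ} (a : A) (α : Fin (q + 1) → A) (j : Fin (q + 1)) :
    (Fin.cons a α : Fin (q + 2) → A) ∘ j.succ.succAbove = Fin.cons a (α ∘ j.succAbove) := by
  funext k
  cases k using Fin.cases with
  | zero => simp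
  | succ k => simp

lemma box_le_cons (V : QOpen ρ) (a : A) {k : ℕ} (α : Fin k → A) :
    (𝔘.box (𝔘.box V fun _ : Fin 1 => a) α).carrier ≤ (𝔘.box V (Fin.cons a α)).carrier := by
  intro x hx
  refine ⟨hx.1.1, (𝔘.mem_inter _ _).2 fun i => ?_⟩
  cases i using Fin.cases with
  | zero => exact (𝔘.mem_inter _ _).1 hx.1.2 0
  | succ i => exact (𝔘.mem_inter _ _).1 hx.2 i

/-- Local exactness on sections implies exactness of a sequence of equivariant sheaves. -/
lemma sheaf_exact_of_local (S : ShortComplex (Sheaf (topology ρ) AddCommGrpCat.{u}))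
    (h : ∀ (V : QOpen ρ) (s : S.X₂.obj.obj (op V)), (S.g.hom.app (op V)).hom s = 0 →
      ∀ x ∈ V.carrier, ∃ (W : QOpen ρ) (i : W ⟶ V), (∃ y ∈ W.carrier, (ρ.act (elt i)) y = x) ∧
        ∃ t : S.X₁.obj.obj (op W), (S.f.hom.app (op W)).hom t = pull S.X₂.obj i s) :
    S.Exact := by
  -- Exactness means that `S.f` maps onto the kernel of `S.g`, and an epimorphism of sheaves is a
  -- locally surjective map. Injectivity of the kernel inclusion on sections lets the lift be
  -- checked in `S.X₂`.
  rw [S.exact_iff_epi_kernel_lift, ← Sheaf.isLocallySurjective_iff_epi']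
  have hmono : ∀ V : QOpen ρ, Function.Injective ((kernel.ι S.g).hom.app (op V)).hom := by
    intro V
    have : Mono ((sheafToPresheaf _ _).map (kernel.ι S.g)) := inferInstance
    have h2 : Mono (((sheafToPresheaf _ _).map (kernel.ι S.g)).app (op V)) := inferInstance
    exact (AddCommGrpCat.mono_iff_injective _).1 h2
  refine ⟨fun {V} s x hx => ?_⟩
  have hs0 : (S.g.hom.app (op V)).hom (((kernel.ι S.g).hom.app (op V)).hom s) = 0 :=
    congrArg (fun k : kernel S.g ⟶ S.X₃ => (k.hom.app (op V)).hom s) (kernel.condition S.g)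
  obtain ⟨W, i, hy, t, ht⟩ := h V (((kernel.ι S.g).hom.app (op V)).hom s) hs0 x hx
  refine ⟨W, i, ⟨t, hmono W ?_⟩, hy⟩
  have h1 : ((kernel.ι S.g).hom.app (op W)).hom
      (((kernel.lift S.g S.f S.zero).hom.app (op W)).hom t) = (S.f.hom.app (op W)).hom t :=
    congrArg (fun k : S.X₁ ⟶ S.X₂ => (k.hom.app (op W)).hom t) (kernel.lift_ι S.g S.f S.zero)
  refine h1.trans (ht.trans ?_)
  exact (congrArg (fun k => k.hom s) ((kernel.ι S.g).hom.naturality i.op)).symm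

/-- The contracting homotopy `s ↦ (s_{a, α})_α` of the Čech complex over `V ∩ U_a`. -/
def contract (P : (QOpen ρ)ᵒᵖ ⥤ AddCommGrpCat.{u}) (q : ℕ) (V : QOpen ρ) (a : A)
    (s : 𝔘.cochains P (q + 1) V) : 𝔘.cochains P q (𝔘.box V fun _ : Fin 1 => a) :=
  ⟨fun α => pull P (incl (𝔘.box_le_cons V a α)) (s.1 (Fin.cons a α)), by
    refine ⟨fun σ α => ?_, fun α hα => ?_⟩
    · obtain ⟨σ', hs, hc⟩ := exists_perm_cons (A := A) σ
      rw [← hs, ← map_zsmul, ← s.2.1 σ' (Fin.cons a α), ← pull_comp, ← pull_comp]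
      exact 𝔘.pull_congr P s.1 (hc a α).symm _ _ (by simp)
    · change pull P _ (s.1 (Fin.cons a α)) = 0
      rw [s.2.2 _ fun h => hα fun i j hij => ?_, map_zero]
      exact Fin.succ_injective _ (h (by simpa using hij))⟩

/-- Evaluate `ds = 0` at `(a, α)`: the term omitting `a` is `s_α`, and the other terms are minus the
differential of the contracted family. So a cocycle becomes a coboundary over `U_a`. -/
lemma cechDiff_contract (P : (QOpen ρ)ᵒᵖ ⥤ AddCommGrpCat.{u}) (q : ℕ) (V : QOpen ρ) (a : A)
    (s : 𝔘.cochains P (q + 1) V) (hs : 𝔘.cechDiff P (q + 1) V s = 0) :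
    𝔘.cechDiff P q _ (𝔘.contract P q V a s) =
      𝔘.cochainsPull P (q + 1) (incl (𝔘.box_le V fun _ : Fin 1 => a)) s := by
  refine Subtype.ext (funext fun α => ?_)
  have h := congrArg (fun t : 𝔘.cochains P (q + 2) V =>
    pull P (incl (𝔘.box_le_cons V a α)) (t.1 (Fin.cons a α))) hs
  change pull P (incl (𝔘.box_le_cons V a α)) ((𝔘.cechDiff P (q + 1) V s).1 (Fin.cons a α)) =
    pull P (incl (𝔘.box_le_cons V a α)) 0 at h
  rw [cechDiff_apply, map_zero, map_sum, Fin.sum_univ_succ] at h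
  simp only [map_neg, map_zsmul, ← pull_comp, Fin.val_zero, pow_zero, one_smul, Fin.val_succ,
    pow_succ, mul_neg, mul_one, neg_smul, Finset.sum_neg_distrib] at h
  rw [add_neg_eq_zero] at h
  rw [cechDiff_apply]
  refine Eq.trans (Finset.sum_congr rfl fun j _ => ?_) (h.symm.trans ?_)
  · congr 1
    refine (pull_comp P _ _ _).symm.trans ?_
    exact 𝔘.pull_congr P s.1 (cons_comp_succAbove_succ a α j).symm _ _ (by simp)
  · exact 𝔘.pull_congr P s.1 (by simp) _ _ (mul_one (1 : G))

/-- The bottom degree of the contraction: `ds = 0` at the pair `(a, α)` reads `s_α = s_a` on the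
overlap, so over `U_a` the section `s_a` induces the whole family. -/
lemma augment_contract (P : (QOpen ρ)ᵒᵖ ⥤ AddCommGrpCat.{u}) (V : QOpen ρ) (a : A)
    (s : 𝔘.cochains P 0 V) (hs : 𝔘.cechDiff P 0 V s = 0) :
    𝔘.augment P (𝔘.box V fun _ : Fin 1 => a) (s.1 fun _ => a) =
      𝔘.cochainsPull P 0 (incl (𝔘.box_le V fun _ : Fin 1 => a)) s := by
  refine Subtype.ext (funext fun α => ?_)
  have h := congrArg (fun t : 𝔘.cochains P 1 V =>
    pull P (incl (𝔘.box_le_cons V a α)) (t.1 (Fin.cons a α))) hs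
  change pull P (incl (𝔘.box_le_cons V a α)) ((𝔘.cechDiff P 0 V s).1 (Fin.cons a α)) =
    pull P (incl (𝔘.box_le_cons V a α)) 0 at h
  rw [cechDiff_apply, map_zero, map_sum, Fin.sum_univ_two] at h
  simp only [map_neg, ← pull_comp, Fin.val_zero, pow_zero, one_smul, Fin.val_one,
    pow_one, neg_smul] at h
  rw [add_neg_eq_zero] at h
  refine Eq.trans ?_ (h.symm.trans ?_)
  · refine 𝔘.pull_congr P s.1 (funext fun i => ?_) _ _ (mul_one (1 : G)).symm
    obtain rfl : i = 0 := Subsingleton.elim (α := Fin 1) _ _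
    rfl
  · exact 𝔘.pull_congr P s.1 (by simp) _ _ (mul_one (1 : G))

lemma cechAugmentation_app (F : Sheaf (topology ρ) AddCommGrpCat.{u}) (V : QOpen ρ)
    (s : F.obj.obj (op V)) :
    (((𝔘.cechAugmentation F).f 0).hom.app (op V)).hom s = 𝔘.augment F.obj V s := by
  simp only [cechAugmentation, CochainComplex.fromSingle₀Equiv_symm_apply_f_zero]
  rfl

lemma cechComplex_d_app (F : Sheaf (topology ρ) AddCommGrpCat.{u}) (q : ℕ) (V : QOpen ρ)
    (s : 𝔘.cochains F.obj q V) :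
    (((𝔘.cechComplex F).d q (q + 1)).hom.app (op V)).hom s = 𝔘.cechDiff F.obj q V s := by
  rw [cechComplex_d]
  rfl

/-- The augmented Čech complex of an open cover is a resolution. -/
lemma isResolution_cech (F : Sheaf (topology ρ) AddCommGrpCat.{u})
    (hcov : ∀ x : X, ∃ a, x ∈ 𝔘.opens a) : IsResolution (𝔘.cechAugmentation F) := by
  have hlocal : ∀ (V : QOpen ρ), ∀ x ∈ V.carrier, ∃ a : A,
      ∃ y ∈ (𝔘.box V fun _ : Fin 1 => a).carrier,
        (ρ.act (elt (incl (𝔘.box_le V fun _ : Fin 1 => a)))) y = x := by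
    intro V x hx
    obtain ⟨a, ha⟩ := hcov x
    exact ⟨a, x, ⟨hx, (𝔘.mem_inter _ _).2 fun _ => ha⟩, act_one_apply ρ x⟩
  have hzero : (𝔘.cechAugmentation F).f 0 ≫ (𝔘.cechComplex F).d 0 1 = 0 := by
    rw [(𝔘.cechAugmentation F).comm 0 1, HomologicalComplex.single_obj_d, zero_comp]
  refine ⟨?_, hzero, ?_, fun q => ?_⟩
  -- The augmentation is a monomorphism iff `0 → F → 𝒞^0` is exact. A section with zero augmentation
  -- already vanishes on each `V ∩ U_a`, so the local preimage is `0`.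
  · refine (ShortComplex.exact_iff_mono (ShortComplex.mk
      (0 : F ⟶ _) ((𝔘.cechAugmentation F).f 0)
      zero_comp) rfl).1 (sheaf_exact_of_local _ fun V s hs x hx => ?_)
    obtain ⟨a, hy⟩ := hlocal V x hx
    refine ⟨_, _, hy, 0, (map_zero _).trans ?_⟩
    have h := (𝔘.cechAugmentation_app F V s).symm.trans hs
    exact (congrArg (fun t : 𝔘.cochains F.obj 0 V => t.1 fun _ => a) h).symm
  · refine sheaf_exact_of_local _ fun V s hs x hx => ?_
    obtain ⟨a, hy⟩ := hlocal V x hx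
    refine ⟨_, _, hy, (show 𝔘.cochains F.obj 0 V from s).1 fun _ => a, (𝔘.cechAugmentation_app F _ _).trans ?_⟩
    exact 𝔘.augment_contract F.obj V a s ((𝔘.cechComplex_d_app F 0 V s).symm.trans hs)
  · refine sheaf_exact_of_local _ fun V s hs x hx => ?_
    obtain ⟨a, hy⟩ := hlocal V x hx
    refine ⟨_, _, hy, 𝔘.contract F.obj q V a s, (𝔘.cechComplex_d_app F q _ _).trans ?_⟩
    exact 𝔘.cechDiff_contract F.obj q V a s ((𝔘.cechComplex_d_app F (q + 1) V s).symm.trans hs)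

/-- If the augmented Čech complex is a resolution, every cocycle has exactly one class. -/
lemma existsUnique_isClassOf (F : Sheaf (topology ρ) AddCommGrpCat.{u})
    (h : IsResolution (𝔘.cechAugmentation F)) {m : ℕ} (z : (𝔘.equivariantCechComplex F).X m)
    (hz : ((𝔘.equivariantCechComplex F).d m (m + 1)).hom z = 0) :
    ∃! c : equivariantCohomology ρ m F, 𝔘.IsClassOf F z c := by
  have hmono := (AddCommGrpCat.mono_iff_injective ((𝔘.equivariantCechComplex F).iCycles m)).1
    inferInstance
  obtain ⟨ζ, hζ⟩ : ∃ ζ : (𝔘.equivariantCechComplex F).cycles m,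
      ((𝔘.equivariantCechComplex F).iCycles m).hom ζ = z := by
    have hex := (ShortComplex.ab_exact_iff _).1 (ShortComplex.exact_of_f_is_kernel
      (ShortComplex.mk _ _ ((𝔘.equivariantCechComplex F).iCycles_d m (m + 1)))
      ((𝔘.equivariantCechComplex F).cyclesIsKernel m (m + 1) (by simp)))
    exact hex z hz
  let I : InjectiveResolution F := injectiveResolution F
  obtain ⟨φ, hφ⟩ := h.exists_desc I
  refine ⟨(I.isoRightDerivedObj (equivariantSections ρ) m).inv.hom
    ((HomologicalComplex.homologyMap
        (((equivariantSections ρ).mapHomologicalComplex (ComplexShape.up ℕ)).map φ) m).hom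
        (((𝔘.equivariantCechComplex F).homologyπ m).hom ζ)), ⟨ζ, I, φ, hζ, hφ, ?_⟩, ?_⟩
  · exact congrArg (fun k => k.hom ((HomologicalComplex.homologyMap
        (((equivariantSections ρ).mapHomologicalComplex (ComplexShape.up ℕ)).map φ) m).hom
        (((𝔘.equivariantCechComplex F).homologyπ m).hom ζ)))
      (I.isoRightDerivedObj (equivariantSections ρ) m).inv_hom_id
  · rintro c ⟨ζ', J, ψ, hζ', hψ, hc⟩
    obtain rfl : ζ' = ζ := hmono (hζ'.trans hζ.symm)
    -- The competing class may use another resolution `J`. After transport along `e`, both `φ` and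
    -- `ψ ≫ e` extend the augmentation into `I`, hence are homotopic and agree on homology.
    let e := (InjectiveResolution.homotopyEquiv J I).hom
    have he : J.ι ≫ e = I.ι := InjectiveResolution.homotopyEquiv_hom_ι J I
    obtain ⟨s⟩ := h.nonempty_homotopy I φ (ψ ≫ e) (by rw [hφ, reassoc_of% hψ, he])
    have hs := (((equivariantSections ρ).mapHomotopy s).homologyMap_eq m)
    have hn := InjectiveResolution.isoRightDerivedObj_hom_naturality (𝟙 F) J I e
      (by rw [← HomologicalComplex.comp_f, he]; exact (Category.id_comp _).symm) (equivariantSections ρ) m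
    rw [CategoryTheory.Functor.map_id, Category.id_comp] at hn
    rw [Functor.map_comp, HomologicalComplex.homologyMap_comp] at hs
    have h1 := congrArg (fun k => k.hom c) hn
    have h2 := congrArg (fun k => k.hom (((𝔘.equivariantCechComplex F).homologyπ m).hom ζ')) hs
    have h3 := congrArg (HomologicalComplex.homologyMap
        (((equivariantSections ρ).mapHomologicalComplex (ComplexShape.up ℕ)).map e) m).hom hc
    have h4 := congrArg (fun k => k.hom c)
      (I.isoRightDerivedObj (equivariantSections ρ) m).hom_inv_id
    exact h4.symm.trans (congrArg (I.isoRightDerivedObj (equivariantSections ρ) m).inv.hom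
      (h1.trans (h3.trans h2.symm)))

end EquivariantFamily

end CechClass

end Shintani

namespace Shintani

open CategoryTheory Limits

open AlgebraicGeometry Opposite QOpen NumberField Module

universe u

/-! ### The open sets of primitive elements cover the punctured torus. -/

section Cover

variable {F : Type u} [Field F]

/-- The exponents `β` with `t^β ≡ 1` modulo a given ideal. -/
def unitExponents (I : Ideal (CoordRing F)) : AddSubgroup (𝓞 F) where
  carrier := {β | 1 - monom β ∈ I}
  zero_mem' := by
    change 1 - monom 0 ∈ I
    rw [show (monom 0 : CoordRing F) = 1 from rfl, sub_self]
    exact I.zero_mem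
  add_mem' {β γ} hβ hγ := by
    change 1 - monom (β + γ) ∈ I
    have h : (monom (β + γ) : CoordRing F) = monom β * monom γ := by
      simp [monom, AddMonoidAlgebra.single_mul_single]
    have h2 : (1 - monom (β + γ) : CoordRing F) = (1 - monom β) + monom β * (1 - monom γ) := by
      rw [h]; ring
    rw [h2]
    exact I.add_mem hβ (I.mul_mem_left _ hγ)
  neg_mem' {β} hβ := by
    change 1 - monom (-β) ∈ I
    have h : (monom (-β) * monom β : CoordRing F) = 1 := by
      simp [monom, AddMonoidAlgebra.single_mul_single, AddMonoidAlgebra.one_def]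
    have h2 : (1 - monom (-β) : CoordRing F) = -monom (-β) * (1 - monom β) := by
      linear_combination -h
    rw [h2]
    exact I.mul_mem_left _ hβ

/-- If every `t^α` is `1` modulo `I`, the quotient map factors through `t^α ↦ 1`. For a prime ideal
this says that the point lies on the identity section. -/
lemma ker_counit_le_of_unitExponents_eq_top (I : Ideal (CoordRing F)) (hI : unitExponents I = ⊤) :
    RingHom.ker (counit F) ≤ I := by
  have h : Ideal.Quotient.mk I =
      (Int.castRingHom (CoordRing F ⧸ I)).comp (counit F) := by
    refine ringHom_ext_monom fun α => ?_
    have hα : 1 - monom α ∈ I := (hI ▸ AddSubgroup.mem_top α : α ∈ unitExponents I)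
    have h2 := Ideal.Quotient.eq_zero_iff_mem.2 hα
    rw [map_sub, map_one, sub_eq_zero] at h2
    rw [← h2, RingHom.comp_apply, counit_monom, map_one]
  intro f hf
  rw [← Ideal.Quotient.eq_zero_iff_mem, h, RingHom.comp_apply, RingHom.mem_ker.1 hf, map_zero]

variable [NumberField F]

/-- Descent on the norm: a totally positive integer that is not primitive is `N β` with `N > 1` and
`β` totally positive, and the norm of `β` is smaller by the factor `N ^ [F : ℚ]`. -/
lemma mem_of_isTotPos {n : ℕ} (τ : Fin (n + 1) ≃ (F →+* ℝ)) (H : AddSubgroup (𝓞 F))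
    (hH : primitives F ⊆ H) (α : 𝓞 F) (hα : IsTotPos (α : F)) : α ∈ H := by
  induction hm : (Algebra.norm ℤ α).natAbs using Nat.strong_induction_on generalizing α with
  | _ m ih =>
    by_cases hp : α ∈ primitives F
    · exact hH hp
    · have h : ∃ N : ℕ, 1 < N ∧ ∃ β : 𝓞 F, IsTotPos (β : F) ∧ (β : F) = (α : F) / (N : F) := by
        by_contra h
        push Not at h
        exact hp ⟨hα, fun N hN ⟨β, h1, h2⟩ => h N hN β h1 h2⟩
      obtain ⟨N, hN, β, hβ, he⟩ := h
      have hN0 : (N : F) ≠ 0 := by exact_mod_cast (by omega : N ≠ 0)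
      have hαβ : α = N • β := by
        apply RingOfIntegers.coe_injective
        rw [nsmul_eq_mul]
        push_cast
        change (α : F) = algebraMap (𝓞 F) F (N * β)
        rw [map_mul, map_natCast]
        change (α : F) = N * (β : F)
        rw [he]
        field_simp
      rw [hαβ]
      refine H.nsmul_mem (ih _ ?_ β hβ rfl) N
      have hβ0 : β ≠ 0 := by
        rintro rfl
        -- Total positivity excludes `0` only if a real embedding exists; `τ 0` is one.
        have := hβ (τ 0)
        simp at this
      have hn : Algebra.norm ℤ β ≠ 0 := (Algebra.norm_ne_zero_iff).2 hβ0
      have hnorm : Algebra.norm ℤ α = (N : ℤ) ^ finrank ℤ (𝓞 F) * Algebra.norm ℤ β := by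
        rw [hαβ, nsmul_eq_mul, map_mul]
        congr 1
        have := Algebra.norm_algebraMap (R := ℤ) (S := 𝓞 F) (N : ℤ)
        simpa using this
      rw [← hm, hnorm, Int.natAbs_mul, Int.natAbs_pow, Int.natAbs_natCast]
      refine lt_mul_of_one_lt_left (Int.natAbs_pos.2 hn) (Nat.one_lt_pow ?_ hN)
      rw [RingOfIntegers.rank]
      exact (finrank_pos).ne'

/-- Every integer is a difference `(β + M) - M` of totally positive ones, with `M` a natural number
exceeding all `|τ_i β|`. -/
lemma eq_top_of_primitives_subset {n : ℕ} (τ : Fin (n + 1) ≃ (F →+* ℝ)) (H : AddSubgroup (𝓞 F))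
    (hH : primitives F ⊆ H) : H = ⊤ := by
  refine eq_top_iff.2 fun β _ => ?_
  obtain ⟨M, hM⟩ := exists_nat_gt (∑ i, |τ i (β : F)|)
  have hlt : ∀ φ : F →+* ℝ, |φ (β : F)| < M := by
    intro φ
    refine lt_of_le_of_lt ?_ hM
    have := Finset.single_le_sum (f := fun i => |τ i (β : F)|) (fun i _ => abs_nonneg _)
      (Finset.mem_univ (τ.symm φ))
    simpa using this
  have h1 : (M : 𝓞 F) ∈ H := mem_of_isTotPos τ H hH _ fun φ => by
    have : (0 : ℝ) < M := lt_of_le_of_lt (abs_nonneg _) (hlt φ)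
    simpa using this
  have h2 : β + (M : 𝓞 F) ∈ H := mem_of_isTotPos τ H hH _ fun φ => by
    have h := neg_abs_le (φ (β : F))
    have h' := hlt φ
    simp only [map_add, map_natCast]
    linarith
  simpa using H.sub_mem h2 h1

/-- The open subsets `U_α`, for `α` primitive, cover the punctured torus. -/
lemma exists_mem_standardCover_opens {n : ℕ} (τ : Fin (n + 1) ≃ (F →+* ℝ))
    (x : (puncturedTorus F).toScheme) : ∃ a, x ∈ (standardCover F).opens a := by
  by_contra hx
  push Not at hx
  let p : PrimeSpectrum (CoordRing F) := (puncturedTorus F).ι x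
  have hp : p ∈ puncturedTorus F := x.2
  have hH : primitives F ⊆ unitExponents p.asIdeal := by
    intro a ha
    by_contra h
    exact hx ⟨a, ha⟩ h
  have hle := ker_counit_le_of_unitExponents_eq_top _ (eq_top_of_primitives_subset τ _ hH)
  apply hp
  exact (range_comap_of_surjective _ (counit F) fun n => ⟨n, by simp⟩).symm ▸ hle

end Cover

end Shintani

namespace Shintani

open NumberField Module Filter Topology

/-! ### The signed relation between real cones. -/

section RealCones

/-- On a line `t ↦ p - t c` in general position, the signed number of points at which the line enters or
leaves the closed positive orthant vanishes. -/
lemma sum_sign_orthant_eq_zero {ι : Type*} [Fintype ι] (p c : ι → ℝ)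
    (hpos : ∃ j, 0 < c j) (hneg : ∃ j, c j < 0)
    (hne : ∀ j k, j ≠ k → c j ≠ 0 → c k ≠ 0 → p k - p j / c j * c k ≠ 0)
    [∀ j, Decidable (∀ k, 0 ≤ p k - p j / c j * c k)] :
    ∑ j, ((SignType.sign (c j) : SignType) : ℤ) *
      (if ∀ k, 0 ≤ p k - p j / c j * c k then 1 else 0) = 0 := by
  classical
  -- As `t` grows, `p - t c` leaves the half-spaces with `c j > 0`, first at `a`, and enters those
  -- with `c j < 0`, last at `b`. Only these two crossings can lie in the orthant.
  obtain ⟨a, ha, hamin⟩ := (Finset.univ.filter fun j => 0 < c j).exists_min_image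
    (fun j => p j / c j) (by obtain ⟨j, hj⟩ := hpos; exact ⟨j, by simpa using hj⟩)
  obtain ⟨b, hb, hbmax⟩ := (Finset.univ.filter fun j => c j < 0).exists_max_image
    (fun j => p j / c j) (by obtain ⟨j, hj⟩ := hneg; exact ⟨j, by simpa using hj⟩)
  simp only [Finset.mem_filter, Finset.mem_univ, true_and] at ha hb hamin hbmax
  have key : ∀ j k, c k ≠ 0 → p k - p j / c j * c k = (p k / c k - p j / c j) * c k := by
    intro j k hk
    field_simp
  have hpk : ∀ j k, 0 < c k → (0 ≤ p k - p j / c j * c k ↔ p j / c j ≤ p k / c k) := by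
    intro j k hk
    rw [key j k hk.ne', mul_nonneg_iff_of_pos_right hk, sub_nonneg]
  have hnk : ∀ j k, c k < 0 → (0 ≤ p k - p j / c j * c k ↔ p k / c k ≤ p j / c j) := by
    intro j k hk
    rw [key j k hk.ne, ← sub_nonpos (a := p k / c k)]
    constructor <;> intro h <;> nlinarith
  have hab : a ≠ b := by rintro rfl; exact lt_asymm ha hb
  -- Either crossing lies in the orthant exactly when the last entry does not come after the first
  -- exit and the coordinates that are constant along the line are nonnegative.
  have hQ : (∀ k, 0 ≤ p k - p a / c a * c k) ↔ ∀ k, 0 ≤ p k - p b / c b * c k := by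
    constructor
    · intro h k
      rcases lt_trichotomy (c k) 0 with hk | hk | hk
      · exact (hnk b k hk).2 (hbmax k hk)
      · simpa [hk] using h k
      · exact (hpk b k hk).2 (((hnk a b hb).1 (h b)).trans (hamin k hk))
    · intro h k
      rcases lt_trichotomy (c k) 0 with hk | hk | hk
      · exact (hnk a k hk).2 ((hbmax k hk).trans ((hpk b a ha).1 (h a)))
      · simpa [hk] using h k
      · exact (hpk a k hk).2 (hamin k hk)
  rw [Fintype.sum_eq_add a b hab]
  · rw [sign_pos ha, sign_neg hb]
    by_cases h : ∀ k, 0 ≤ p k - p b / c b * c k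
    · rw [if_pos (hQ.2 h), if_pos h]; simp
    · rw [if_neg (mt hQ.1 h), if_neg h]; simp
  -- Any other crossing in the orthant would have the same parameter as `a` or `b`, so two
  -- coordinates would vanish at once, against general position.
  · rintro j ⟨hja, hjb⟩
    rcases lt_trichotomy (c j) 0 with hj | hj | hj
    · rw [if_neg, mul_zero]
      intro h
      refine hne j b hjb hj.ne hb.ne ?_
      rw [key j b hb.ne, le_antisymm ((hnk j b hb).1 (h b)) (hbmax j hj)]
      ring
    · simp [hj]
    · rw [if_neg, mul_zero]
      intro h
      refine hne j a hja hj.ne' ha.ne' ?_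
      rw [key j a ha.ne', le_antisymm (hamin j hj) ((hpk j a ha).1 (h a))]
      ring

variable {n : ℕ}

/-- The linear relation between `n + 2` vectors of `ℝ^{n+1}` given by their maximal minors. -/
lemma sum_minors_mul_eq_zero (B : Matrix (Fin (n + 1)) (Fin (n + 2)) ℝ) (i : Fin (n + 1)) :
    ∑ j : Fin (n + 2), (-1) ^ (j : ℕ) * (B.submatrix id j.succAbove).det * B i j = 0 := by
  -- Repeating row `i` on top gives a singular square matrix; expanding its determinant along the
  -- top row is the relation.
  let A : Matrix (Fin (n + 2)) (Fin (n + 2)) ℝ := Matrix.of (Fin.cons (B i) B)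
  have h0 : A.det = 0 := Matrix.det_zero_of_row_eq (i := 0) (j := i.succ)
    (Fin.succ_ne_zero i).symm rfl
  rw [Matrix.det_succ_row_zero] at h0
  rw [← h0]
  refine Finset.sum_congr rfl fun j _ => ?_
  have h1 : A.submatrix Fin.succ j.succAbove = B.submatrix id j.succAbove := by
    rfl
  have h2 : A 0 j = B i j := rfl
  rw [h1, h2]
  ring

/-- The signed sum of the indicator functions of the cones spanned by the `n + 1`-element subfamilies of
`n + 2` vectors in a half space vanishes at every point in general position. -/
lemma sum_sign_cone_eq_zero (B : Matrix (Fin (n + 1)) (Fin (n + 2)) ℝ) (hB : ∀ j, 0 < B 0 j)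
    (v : Fin (n + 1) → ℝ)
    (hv : ∀ j, (B.submatrix id (Fin.succAbove j)).det ≠ 0 →
      ∀ k, ((B.submatrix id (Fin.succAbove j))⁻¹.mulVec v) k ≠ 0)
    [∀ j : Fin (n + 2), Decidable (∀ k, 0 ≤ ((B.submatrix id j.succAbove)⁻¹.mulVec v) k)] :
    ∑ j : Fin (n + 2), (-1 : ℤ) ^ (j : ℕ) *
      ((SignType.sign (B.submatrix id j.succAbove).det : SignType) : ℤ) *
      (if ∀ k, 0 ≤ ((B.submatrix id j.succAbove)⁻¹.mulVec v) k then 1 else 0) = 0 := by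
  classical
  let c : Fin (n + 2) → ℝ := fun j => (-1) ^ (j : ℕ) * (B.submatrix id j.succAbove).det
  have hdet : ∀ j, c j ≠ 0 → (B.submatrix id j.succAbove).det ≠ 0 := fun j hj h =>
    hj (by simp [c, h])
  have hsign : ∀ j : Fin (n + 2), (-1 : ℤ) ^ (j : ℕ) *
      ((SignType.sign (B.submatrix id j.succAbove).det : SignType) : ℤ) =
      ((SignType.sign (c j) : SignType) : ℤ) := by
    intro j
    rcases neg_one_pow_eq_or ℝ (j : ℕ) with h | h <;>
    rcases neg_one_pow_eq_or ℤ (j : ℕ) with h' | h' <;>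
    rcases Nat.even_or_odd (j : ℕ) with h'' | h'' <;>
    simp [c, h''.neg_one_pow, Left.sign_neg]
  simp only [hsign]
  have hrel : ∀ i, ∑ j, c j * B i j = 0 := sum_minors_mul_eq_zero B
  by_cases hc : ∀ j, c j = 0
  · simp [hc]
  push Not at hc
  obtain ⟨j₀, hj₀⟩ := hc
  -- Row `0` of `B` is positive, so a nonzero relation between the columns must have coefficients of
  -- both signs.
  have hposneg : (∃ j, 0 < c j) ∧ ∃ j, c j < 0 := by
    constructor
    · by_contra h
      push Not at h
      have : ∑ j, c j * B 0 j < 0 := Finset.sum_neg' (fun j _ =>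
        mul_nonpos_of_nonpos_of_nonneg (h j) (hB j).le)
        ⟨j₀, Finset.mem_univ _, mul_neg_of_neg_of_pos (lt_of_le_of_ne (h j₀) hj₀) (hB j₀)⟩
      exact this.ne (hrel 0)
    · by_contra h
      push Not at h
      have : 0 < ∑ j, c j * B 0 j := Finset.sum_pos' (fun j _ => mul_nonneg (h j) (hB j).le)
        ⟨j₀, Finset.mem_univ _, mul_pos (lt_of_le_of_ne (h j₀) hj₀.symm) (hB j₀)⟩
      exact this.ne' (hrel 0)
  -- One representation of `v` by the columns, with coefficient `0` at `j₀`; subtracting multiples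
  -- of `c` gives others.
  let p : Fin (n + 2) → ℝ :=
    j₀.insertNth 0 ((B.submatrix id j₀.succAbove)⁻¹.mulVec v)
  have hp : ∀ i, ∑ k, p k * B i k = v i := by
    intro i
    rw [Fin.sum_univ_succAbove _ j₀]
    have h1 : (B.submatrix id j₀.succAbove).mulVec
        ((B.submatrix id j₀.succAbove)⁻¹.mulVec v) = v := by
      rw [Matrix.mulVec_mulVec, Matrix.mul_nonsing_inv _ (isUnit_iff_ne_zero.2 (hdet j₀ hj₀)),
        Matrix.one_mulVec]
    have h2 := congrFun h1 i
    simp only [p, Fin.insertNth_apply_same, Fin.insertNth_apply_succAbove, zero_mul, zero_add]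
    rw [← h2]
    simp only [Matrix.mulVec, dotProduct, Matrix.submatrix_apply, id]
    exact Finset.sum_congr rfl fun k _ => mul_comm _ _
  -- Subtracting the multiple of `c` that kills the `j`-th coefficient leaves the unique
  -- representation of `v` by the other columns.
  have hcoord : ∀ j, c j ≠ 0 → ∀ k, ((B.submatrix id j.succAbove)⁻¹.mulVec v) k =
      p (j.succAbove k) - p j / c j * c (j.succAbove k) := by
    intro j hj
    have h1 : (B.submatrix id j.succAbove).mulVec
        (fun k => p (j.succAbove k) - p j / c j * c (j.succAbove k)) = v := by
      funext i
      have h2 : ∑ k, (p k - p j / c j * c k) * B i k = v i := by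
        simp only [sub_mul, Finset.sum_sub_distrib, mul_assoc, ← Finset.mul_sum, hrel, hp,
          mul_zero, sub_zero]
      rw [Fin.sum_univ_succAbove _ j, div_mul_cancel₀ _ hj, sub_self, zero_mul, zero_add] at h2
      rw [← h2]
      simp only [Matrix.mulVec, dotProduct, Matrix.submatrix_apply, id]
      exact Finset.sum_congr rfl fun k _ => mul_comm _ _
    have h3 : (B.submatrix id j.succAbove)⁻¹.mulVec v =
        fun k => p (j.succAbove k) - p j / c j * c (j.succAbove k) := by
      conv_lhs => rw [← h1]
      rw [Matrix.mulVec_mulVec, Matrix.nonsing_inv_mul _ (isUnit_iff_ne_zero.2 (hdet j hj)),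
        Matrix.one_mulVec]
    exact fun k => congrFun h3 k
  refine Eq.trans (Finset.sum_congr rfl fun j _ => ?_)
    (sum_sign_orthant_eq_zero p c hposneg.1 hposneg.2 ?_)
  · by_cases hj : c j = 0
    · simp [hj]
    · congr 1
      refine if_congr ?_ rfl rfl
      rw [Fin.forall_iff_succAbove j (P := fun k => 0 ≤ p k - p j / c j * c k)]
      rw [div_mul_cancel₀ _ hj, sub_self]
      simp [hcoord j hj]
  · intro j k hjk hj hk
    obtain ⟨l, rfl⟩ := Fin.exists_succAbove_eq hjk.symm
    rw [← hcoord j hj]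
    exact hv j (hdet j hj) l

end RealCones

/-! ### Signs of affine functions just to the right of zero. -/

section Germs

/-- The condition that `x - δ y ≥ 0` for all small `δ > 0`. -/
def EventuallyNonneg (y x : ℝ) : Prop := ∀ᶠ δ in 𝓝[>] (0 : ℝ), 0 ≤ x - δ * y

lemma eventually_sub_mul_pos {x y : ℝ} (h : 0 < x ∨ x = 0 ∧ y < 0) :
    ∀ᶠ δ in 𝓝[>] (0 : ℝ), 0 < x - δ * y := by
  rcases h with h | ⟨rfl, h⟩
  · have hc : Tendsto (fun δ : ℝ => x - δ * y) (𝓝[>] 0) (𝓝 (x - 0 * y)) :=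
      ((continuous_const.sub (continuous_id.mul continuous_const)).tendsto 0).mono_left
        nhdsWithin_le_nhds
    exact hc.eventually (lt_mem_nhds (by simpa using h))
  · filter_upwards [self_mem_nhdsWithin] with δ hδ
    have : δ * y < 0 := mul_neg_of_pos_of_neg hδ h
    linarith

/-- An affine function of `δ` with nonzero slope has constant nonzero sign on some interval to the
right of `0`, decided by `x`, and by the slope if `x = 0`. -/
lemma eventually_pos_or_neg {y : ℝ} (hy : y ≠ 0) (x : ℝ) :
    (∀ᶠ δ in 𝓝[>] (0 : ℝ), 0 < x - δ * y) ∨ ∀ᶠ δ in 𝓝[>] (0 : ℝ), x - δ * y < 0 := by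
  by_cases h : 0 < x ∨ x = 0 ∧ y < 0
  · exact Or.inl (eventually_sub_mul_pos h)
  · right
    have h' : 0 < -x ∨ -x = 0 ∧ -y < 0 := by
      rcases lt_trichotomy x 0 with hx | hx | hx
      · left; linarith
      · right
        refine ⟨by linarith, ?_⟩
        rcases hy.lt_or_gt with h1 | h1
        · exact absurd (Or.inr ⟨hx, h1⟩) h
        · linarith
      · exact absurd (Or.inl hx) h
    filter_upwards [eventually_sub_mul_pos h'] with δ hδ
    linarith

/-- Replaces the condition on germs by an inequality at a single small `δ`, where the value is
moreover nonzero; finitely many such conditions share one `δ`. -/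
lemma eventuallyNonneg_iff_of_ne {y : ℝ} (hy : y ≠ 0) (x : ℝ) :
    ∀ᶠ δ in 𝓝[>] (0 : ℝ), (EventuallyNonneg y x ↔ 0 ≤ x - δ * y) ∧ x - δ * y ≠ 0 := by
  rcases eventually_pos_or_neg hy x with h | h
  · have h1 : EventuallyNonneg y x := h.mono fun δ hδ => hδ.le
    filter_upwards [h] with δ hδ
    exact ⟨⟨fun _ => hδ.le, fun _ => h1⟩, hδ.ne'⟩
  · have h1 : ¬ EventuallyNonneg y x := fun h1 => by
      obtain ⟨δ, h2, h3⟩ := (h.and h1).exists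
      linarith
    filter_upwards [h] with δ hδ
    exact ⟨⟨fun h2 => absurd h2 h1, fun h2 => absurd h2 (not_le.2 hδ)⟩, hδ.ne⟩

lemma not_eventuallyNonneg_iff {y : ℝ} (hy : y ≠ 0) (x : ℝ) :
    ¬ EventuallyNonneg y x ↔ ∀ᶠ δ in 𝓝[>] (0 : ℝ), x - δ * y < 0 := by
  constructor
  · intro h
    refine (eventually_pos_or_neg hy x).resolve_left fun h1 => h (h1.mono fun δ hδ => hδ.le)
  · intro h h1
    obtain ⟨δ, h2, h3⟩ := (h.and h1).exists
    linarith

lemma EventuallyNonneg.nonneg {y x : ℝ} (h : EventuallyNonneg y x) : 0 ≤ x := by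
  have hc : Tendsto (fun δ : ℝ => x - δ * y) (𝓝[>] 0) (𝓝 (x - 0 * y)) :=
    ((continuous_const.sub (continuous_id.mul continuous_const)).tendsto 0).mono_left
      nhdsWithin_le_nhds
  simpa using ge_of_tendsto hc h

lemma EventuallyNonneg.neg_of_eq_zero {y : ℝ} (hy : y ≠ 0) (h : EventuallyNonneg y 0) :
    y < 0 := by
  obtain ⟨δ, h1, h2⟩ := (h.and self_mem_nhdsWithin).exists
  have h3 : (0 : ℝ) < δ := h2
  refine lt_of_le_of_ne ?_ hy
  by_contra h4
  push Not at h4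
  have := mul_pos h3 h4
  linarith

end Germs

end Shintani

namespace Shintani

open NumberField Module Filter Topology

universe u

/-! ### The matrix of embeddings and the dual basis. -/

section EmbeddingMatrix

variable {F : Type u} [Field F] {n : ℕ} (τ : Fin (n + 1) ≃ (F →+* ℝ))

/-- The matrix `(α_j^{τ_i})_{i, j}`. -/
def embedMatrix {m : ℕ} (α : Fin m → primitives F) : Matrix (Fin (n + 1)) (Fin m) ℝ :=
  Matrix.of fun i j => τ i ((α j).1 : F)

lemma embedMatrix_mulVec {m : ℕ} (α : Fin m → primitives F) (x : Fin m → ℝ) :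
    (embedMatrix τ α).mulVec x = ∑ j, x j • embed τ ((α j).1 : F) := by
  funext i
  simp [embedMatrix, embed, Matrix.mulVec, dotProduct, mul_comm]

variable [NumberField F]

/-- The rational trace is the sum over the real embeddings, when there are enough of them. -/
lemma sum_real_embeddings_eq_trace (hn : finrank ℚ F = n + 1) (x : F) :
    ∑ i, τ i x = ((Algebra.trace ℚ F x : ℚ) : ℝ) := by
  let f : Fin (n + 1) → (F →ₐ[ℚ] ℂ) := fun i => (Complex.ofRealHom.comp (τ i)).toRatAlgHom
  have hf : Function.Injective f := by
    intro i j hij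
    apply τ.injective
    ext x
    have := congrArg (fun φ : F →ₐ[ℚ] ℂ => φ x) hij
    exact Complex.ofReal_injective this
  -- There are as many real embeddings as the degree, so they exhaust the complex ones.
  have hb : Function.Bijective f := by
    rw [Fintype.bijective_iff_injective_and_card]
    refine ⟨hf, ?_⟩
    rw [Fintype.card_fin, ← hn, AlgHom.card]
  have h := trace_eq_sum_embeddings (K := ℚ) (L := F) ℂ (x := x)
  rw [← hb.sum_comp (fun φ : F →ₐ[ℚ] ℂ => φ x)] at h
  apply Complex.ofReal_injective
  rw [Complex.ofReal_sum]
  refine Eq.trans ?_ (h.symm.trans ?_)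
  · rfl
  · simp

/-- No entry of the inverse of the matrix of embeddings of a basis of `F` vanishes: its rows are the
conjugates of the elements of the dual basis. -/
lemma embedMatrix_inv_ne_zero (hn : finrank ℚ F = n + 1) (α : Fin (n + 1) → primitives F)
    (hα : (embedMatrix τ α).det ≠ 0) (k i : Fin (n + 1)) : (embedMatrix τ α)⁻¹ k i ≠ 0 := by
  set M := embedMatrix τ α
  -- The rational Gram matrix of the trace form. It equals `Mᵀ M` over `ℝ`, so it is invertible and
  -- `M⁻¹ = T⁻¹ Mᵀ`.
  let T : Matrix (Fin (n + 1)) (Fin (n + 1)) ℚ :=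
    Matrix.of fun j l => Algebra.trace ℚ F (((α j).1 : F) * ((α l).1 : F))
  have hT : T.map (algebraMap ℚ ℝ) = M.transpose * M := by
    ext j l
    have := sum_real_embeddings_eq_trace τ hn (((α j).1 : F) * ((α l).1 : F))
    simp only [map_mul] at this
    simpa [T, M, embedMatrix, Matrix.mul_apply] using this.symm
  have hTdet : IsUnit T.det := by
    rw [isUnit_iff_ne_zero]
    intro h
    have h2 : (T.map (algebraMap ℚ ℝ)).det = 0 := by
      have := (RingHom.map_det (algebraMap ℚ ℝ) T).symm
      rw [h, map_zero] at this
      exact this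
    rw [hT, Matrix.det_mul, Matrix.det_transpose] at h2
    exact hα (mul_self_eq_zero.1 h2)
  have hM : IsUnit M.det := isUnit_iff_ne_zero.2 hα
  have hinv : M⁻¹ = (T⁻¹).map (algebraMap ℚ ℝ) * M.transpose := by
    refine Matrix.inv_eq_left_inv ?_
    rw [Matrix.mul_assoc, ← hT, ← Matrix.map_mul, Matrix.nonsing_inv_mul _ hTdet]
    simp
  -- The `k`-th element of the trace-dual basis. Row `k` of `M⁻¹` consists of its conjugates, so one
  -- zero entry would make the whole row vanish.
  let γ : F := ∑ j, algebraMap ℚ F (T⁻¹ k j) * ((α j).1 : F)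
  have hγ : ∀ i, M⁻¹ k i = τ i γ := by
    intro i
    rw [hinv, Matrix.mul_apply, map_sum]
    refine Finset.sum_congr rfl fun j _ => ?_
    rw [map_mul, Matrix.map_apply, Matrix.transpose_apply]
    congr 1
    simp
  intro h0
  rw [hγ, map_eq_zero] at h0
  have h1 := congrFun (congrFun (Matrix.nonsing_inv_mul M hM) k) k
  rw [Matrix.mul_apply] at h1
  simp [hγ, h0] at h1

end EmbeddingMatrix

/-! ### Lattice points in displaced cones and parallelepipeds. -/

section Cones

variable {F : Type u} [Field F] {n : ℕ} (τ : Fin (n + 1) ≃ (F →+* ℝ))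

/-- The coordinates of `β` with respect to the vectors `α_j`. -/
noncomputable def coords (α : Fin (n + 1) → primitives F) (β : 𝓞 F) : Fin (n + 1) → ℝ :=
  (embedMatrix τ α)⁻¹.mulVec (embed τ (β : F))

/-- Membership of `β`, moved slightly in the negative last coordinate direction, in the cone spanned by the
vectors `α_j`. -/
def InCone (α : Fin (n + 1) → primitives F) (β : 𝓞 F) : Prop :=
  ∀ k, EventuallyNonneg ((embedMatrix τ α)⁻¹ k (Fin.last n)) (coords τ α β k)

lemma inv_mulVec_sub_single (α : Fin (n + 1) → primitives F) (β : 𝓞 F) (δ : ℝ)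
    (k : Fin (n + 1)) :
    ((embedMatrix τ α)⁻¹.mulVec (embed τ (β : F) - Pi.single (Fin.last n) δ)) k =
      coords τ α β k - δ * (embedMatrix τ α)⁻¹ k (Fin.last n) := by
  rw [Matrix.mulVec_sub, Pi.sub_apply, Matrix.mulVec_single]
  simp [coords, mul_comm]

lemma coords_sub (α : Fin (n + 1) → primitives F) (hα : (embedMatrix τ α).det ≠ 0)
    (β : 𝓞 F) (l : Fin (n + 1)) :
    coords τ α (β - (α l).1) = coords τ α β - Pi.single l 1 := by
  have h1 : embed τ ((β - (α l).1 : 𝓞 F) : F) =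
      embed τ (β : F) - (embedMatrix τ α).mulVec (Pi.single l 1) := by
    funext i
    simp [embed, embedMatrix]
  rw [coords, h1, Matrix.mulVec_sub, Matrix.mulVec_mulVec,
    Matrix.nonsing_inv_mul _ (isUnit_iff_ne_zero.2 hα), Matrix.one_mulVec, coords]

lemma mem_parallelepiped_iff (α : Fin (n + 1) → primitives F)
    (hα : (embedMatrix τ α).det ≠ 0) (u : Fin (n + 1) → ℝ) :
    u ∈ parallelepiped τ α ↔ ∀ k, 0 ≤ ((embedMatrix τ α)⁻¹.mulVec u) k ∧
      ((embedMatrix τ α)⁻¹.mulVec u) k < 1 := by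
  constructor
  · rintro ⟨x, hx, rfl⟩
    rw [← embedMatrix_mulVec, Matrix.mulVec_mulVec,
      Matrix.nonsing_inv_mul _ (isUnit_iff_ne_zero.2 hα), Matrix.one_mulVec]
    exact hx
  · intro h
    refine ⟨_, h, ?_⟩
    rw [← embedMatrix_mulVec, Matrix.mulVec_mulVec,
      Matrix.mul_nonsing_inv _ (isUnit_iff_ne_zero.2 hα), Matrix.one_mulVec]

variable [NumberField F]

/-- This makes the positivity requirement in `upperClosure` automatic. Nonnegative coordinates, not
all zero, give a positive vector. If all were zero, the last column of `M⁻¹` would be negative,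
whereas its product with the positive last row of `M` is `1`. -/
lemma embed_pos_of_inCone (hn : finrank ℚ F = n + 1) (α : Fin (n + 1) → primitives F)
    (hα : (embedMatrix τ α).det ≠ 0) (β : 𝓞 F) (h : InCone τ α β) (i : Fin (n + 1)) :
    0 < embed τ (β : F) i := by
  have hu : (embedMatrix τ α).mulVec (coords τ α β) = embed τ (β : F) := by
    rw [coords, Matrix.mulVec_mulVec, Matrix.mul_nonsing_inv _ (isUnit_iff_ne_zero.2 hα),
      Matrix.one_mulVec]
  have hM : ∀ i j, 0 < embedMatrix τ α i j := fun i j => (α j).2.1 (τ i)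
  rw [← hu]
  by_cases h0 : ∃ k, coords τ α β k ≠ 0
  · obtain ⟨k, hk⟩ := h0
    exact Finset.sum_pos' (fun j _ => mul_nonneg (hM i j).le (h j).nonneg)
      ⟨k, Finset.mem_univ k, mul_pos (hM i k) (lt_of_le_of_ne (h k).nonneg hk.symm)⟩
  · push Not at h0
    exfalso
    have hneg : ∀ k, (embedMatrix τ α)⁻¹ k (Fin.last n) < 0 := fun k =>
      (h0 k ▸ h k : EventuallyNonneg _ 0).neg_of_eq_zero (embedMatrix_inv_ne_zero τ hn α hα _ _)
    have h1 := congrFun (congrFun (Matrix.mul_nonsing_inv _ (isUnit_iff_ne_zero.2 hα)) (Fin.last n))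
      (Fin.last n)
    rw [Matrix.mul_apply, Matrix.one_apply_eq] at h1
    have h2 : ∑ j, embedMatrix τ α (Fin.last n) j * (embedMatrix τ α)⁻¹ j (Fin.last n) ≤ 0 :=
      Finset.sum_nonpos fun j _ => mul_nonpos_of_nonneg_of_nonpos (hM _ _).le (hneg j).le
    linarith

/-- The slopes are nonzero, so the displaced coordinate being eventually `< 1` is the negation of
`EventuallyNonneg` at `x_k - 1`. In this form the conditions are those created by multiplication by
`1 - t^{α_k}`. -/
lemma mem_latticePoints_iff (hn : finrank ℚ F = n + 1) (α : Fin (n + 1) → primitives F)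
    (hα : (embedMatrix τ α).det ≠ 0) (β : 𝓞 F) :
    β ∈ latticePoints τ α ↔ ∀ k,
      EventuallyNonneg ((embedMatrix τ α)⁻¹ k (Fin.last n)) (coords τ α β k) ∧
      ¬ EventuallyNonneg ((embedMatrix τ α)⁻¹ k (Fin.last n)) (coords τ α β k - 1) := by
  have hne := fun k => embedMatrix_inv_ne_zero τ hn α hα k (Fin.last n)
  have hev : (∃ δ > 0, ∀ δ', 0 < δ' → δ' < δ →
      embed τ (β : F) - Pi.single (Fin.last n) δ' ∈ parallelepiped τ α) ↔ ∀ k,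
      EventuallyNonneg ((embedMatrix τ α)⁻¹ k (Fin.last n)) (coords τ α β k) ∧
      ¬ EventuallyNonneg ((embedMatrix τ α)⁻¹ k (Fin.last n)) (coords τ α β k - 1) := by
    have h1 : (∃ δ > 0, ∀ δ', 0 < δ' → δ' < δ →
        embed τ (β : F) - Pi.single (Fin.last n) δ' ∈ parallelepiped τ α) ↔
        ∀ᶠ δ in 𝓝[>] (0 : ℝ), embed τ (β : F) - Pi.single (Fin.last n) δ ∈
          parallelepiped τ α := by
      rw [Filter.Eventually, mem_nhdsGT_iff_exists_Ioo_subset]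
      exact ⟨fun ⟨δ, h, h'⟩ => ⟨δ, h, fun x hx => h' x hx.1 hx.2⟩,
        fun ⟨δ, h, h'⟩ => ⟨δ, h, fun x h1 h2 => h' ⟨h1, h2⟩⟩⟩
    rw [h1]
    simp only [mem_parallelepiped_iff τ α hα, inv_mulVec_sub_single, eventually_all,
      eventually_and]
    refine forall_congr' fun k => and_congr Iff.rfl ?_
    rw [not_eventuallyNonneg_iff (hne k)]
    refine eventually_congr (Eventually.of_forall ?_)
    intro δ
    constructor <;> intro h <;> linarith
  rw [← hev]
  refine ⟨fun h => h.2, fun h => ⟨fun i => ?_, h⟩⟩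
  exact embed_pos_of_inCone τ hn α hα β (fun k => (hev.1 h k).1) i

open Classical in
/-- The signed indicator functions of the cones spanned by the `g`-element subfamilies of `g + 1` elements of
`A` add up to zero. -/
lemma sum_sgn_inCone_eq_zero (hn : finrank ℚ F = n + 1) (α : Fin (n + 2) → primitives F)
    (β : 𝓞 F) :
    ∑ j : Fin (n + 2), (-1 : ℤ) ^ (j : ℕ) * sgn τ (α ∘ j.succAbove) *
      (if InCone τ (α ∘ j.succAbove) β then 1 else 0) = 0 := by
  have hev : ∀ j : Fin (n + 2), ∀ᶠ δ in 𝓝[>] (0 : ℝ),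
      (embedMatrix τ (α ∘ j.succAbove)).det ≠ 0 →
      ∀ k, (EventuallyNonneg ((embedMatrix τ (α ∘ j.succAbove))⁻¹ k (Fin.last n))
          (coords τ (α ∘ j.succAbove) β k) ↔
        0 ≤ coords τ (α ∘ j.succAbove) β k -
          δ * (embedMatrix τ (α ∘ j.succAbove))⁻¹ k (Fin.last n)) ∧
        coords τ (α ∘ j.succAbove) β k -
          δ * (embedMatrix τ (α ∘ j.succAbove))⁻¹ k (Fin.last n) ≠ 0 := by
    intro j
    by_cases hj : (embedMatrix τ (α ∘ j.succAbove)).det = 0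
    · exact Eventually.of_forall fun δ h => absurd hj h
    · refine (eventually_all.2 fun k => eventuallyNonneg_iff_of_ne
        (embedMatrix_inv_ne_zero τ hn _ hj k (Fin.last n)) _).mono fun δ h _ => h
  -- One `δ` serves all subfamilies and coordinates, turning the germs into a real point in general
  -- position.
  obtain ⟨δ, hδ⟩ := (eventually_all.2 hev).exists
  refine Eq.trans (Finset.sum_congr rfl fun j _ => ?_)
    (sum_sign_cone_eq_zero (embedMatrix τ α) (fun j => (α j).2.1 (τ 0))
      (embed τ (β : F) - Pi.single (Fin.last n) δ) ?_)
  · change _ * _ * _ = _ * sgn τ (α ∘ j.succAbove) * _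
    -- For a singular matrix `⁻¹` is `0` by convention and the indicator has no meaning; the zero
    -- sign removes the term.
    by_cases hj : (embedMatrix τ (α ∘ j.succAbove)).det = 0
    · have : sgn τ (α ∘ j.succAbove) = 0 := by
        change ((SignType.sign (embedMatrix τ (α ∘ j.succAbove)).det : SignType) : ℤ) = 0
        rw [hj]; simp
      rw [this]; simp
    · congr 1
      refine if_congr (forall_congr' fun k => ?_) rfl rfl
      rw [(hδ j hj k).1, ← inv_mulVec_sub_single]
      rfl
  · intro j hj k
    have := (hδ j hj k).2
    rw [← inv_mulVec_sub_single] at this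
    exact this

end Cones

end Shintani

namespace Shintani

open NumberField Module Filter Topology

universe u

/-! ### From indicator functions of cones to identities in the group ring. -/

section GeneratingFunctions

variable {F : Type u} [Field F]

variable (F) in
/-- The action of the group ring on functions by translation, `(t^α h)(β) = h(β - α)`. -/
noncomputable def shift : CoordRing F →+* Module.End ℤ (𝓞 F → ℤ) :=
  (AddMonoidAlgebra.lift ℤ (Module.End ℤ (𝓞 F → ℤ)) (𝓞 F)
    { toFun := fun α => LinearMap.funLeft ℤ ℤ fun β => β - α.toAdd
      map_one' := by ext h β; simp [LinearMap.funLeft]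
      map_mul' := fun α α' => by
        refine LinearMap.ext fun h => funext fun β => ?_
        simp [LinearMap.funLeft, sub_sub] }).toRingHom

lemma shift_monom (α : 𝓞 F) (h : 𝓞 F → ℤ) (β : 𝓞 F) :
    shift F (monom α) h β = h (β - α) := by
  simp [shift, monom, LinearMap.funLeft]

lemma shift_one_sub_monom (α : 𝓞 F) (h : 𝓞 F → ℤ) (β : 𝓞 F) :
    shift F (1 - monom α) h β = h β - h (β - α) := by
  rw [map_sub, map_one, LinearMap.sub_apply, Pi.sub_apply, shift_monom]
  rfl

lemma coeff_one_sub_monom_mul (α : 𝓞 F) (f : CoordRing F) :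
    (⇑((1 - monom α) * f).coeff : 𝓞 F → ℤ) = shift F (1 - monom α) ⇑f.coeff := by
  funext β
  rw [shift_one_sub_monom, sub_mul, one_mul, AddMonoidAlgebra.coeff_sub, Finsupp.sub_apply, monom,
    AddMonoidAlgebra.coeff_single_mul_apply, one_mul, sub_eq_neg_add β α]

lemma EventuallyNonneg.mono {y x x' : ℝ} (h : EventuallyNonneg y x) (hx : x ≤ x') :
    EventuallyNonneg y x' := by
  refine Filter.Eventually.mono h fun δ hδ => ?_
  linarith

variable {n : ℕ} (τ : Fin (n + 1) ≃ (F →+* ℝ))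

open Classical in
/-- Multiplication by `∏_{k ∈ S} (1 - t^{α_k})` truncates the generating function of the cone in the
directions `α_k`, `k ∈ S`. -/
lemma shift_prod_inCone (α : Fin (n + 1) → primitives F) (hα : (embedMatrix τ α).det ≠ 0)
    (S : Finset (Fin (n + 1))) (β : 𝓞 F) :
    shift F (∏ k ∈ S, (1 - monom (α k).1)) (fun β => if InCone τ α β then 1 else 0) β =
      if ∀ k, EventuallyNonneg ((embedMatrix τ α)⁻¹ k (Fin.last n)) (coords τ α β k) ∧
        (k ∈ S → ¬ EventuallyNonneg ((embedMatrix τ α)⁻¹ k (Fin.last n)) (coords τ α β k - 1))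
      then 1 else 0 := by
  induction S using Finset.induction_on generalizing β with
  | empty =>
    rw [Finset.prod_empty, map_one]
    exact if_congr (by simp [InCone]) rfl rfl
  | insert a S ha ih =>
    rw [Finset.prod_insert ha, map_mul, Module.End.mul_apply, shift_one_sub_monom, ih, ih,
      coords_sub τ α hα]
    let E : Fin (n + 1) → ℝ → Prop := fun k => EventuallyNonneg ((embedMatrix τ α)⁻¹ k (Fin.last n))
    let x : Fin (n + 1) → ℝ := coords τ α β
    -- `R` collects the conditions away from `a`, which translation by `α_a` leaves unchanged. At
    -- `a`, the coordinate drops by `1`, and by monotonicity the difference of the two indicators is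
    -- again an indicator.
    let R : Prop := ∀ k, k ≠ a → E k (x k) ∧ (k ∈ S → ¬ E k (x k - 1))
    have hmono : E a (x a - 1) → E a (x a) := fun h => h.mono (by linarith)
    have h1 : (∀ k, E k (x k) ∧ (k ∈ S → ¬ E k (x k - 1))) ↔ R ∧ E a (x a) := by
      constructor
      · exact fun h => ⟨fun k _ => h k, (h a).1⟩
      · rintro ⟨hR, h⟩ k
        by_cases hk : k = a
        · subst hk; exact ⟨h, fun h' => absurd h' ha⟩
        · exact hR k hk
    have h2 : (∀ k, E k ((x - Pi.single a 1 : Fin (n + 1) → ℝ) k) ∧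
        (k ∈ S → ¬ E k ((x - Pi.single a 1 : Fin (n + 1) → ℝ) k - 1))) ↔
        R ∧ E a (x a - 1) := by
      have hx : ∀ k, k ≠ a → (x - Pi.single a 1 : Fin (n + 1) → ℝ) k = x k := by
        intro k hk
        simp [hk]
      have hxa : (x - Pi.single a 1 : Fin (n + 1) → ℝ) a = x a - 1 := by simp
      constructor
      · exact fun h => ⟨fun k hk => by simpa only [hx k hk] using h k, by
          simpa only [hxa] using (h a).1⟩
      · rintro ⟨hR, h⟩ k
        by_cases hk : k = a
        · subst hk; rw [hxa]; exact ⟨h, fun h' => absurd h' ha⟩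
        · rw [hx k hk]; exact hR k hk
    have h3 : (∀ k, E k (x k) ∧ (k ∈ insert a S → ¬ E k (x k - 1))) ↔
        R ∧ E a (x a) ∧ ¬ E a (x a - 1) := by
      constructor
      · exact fun h => ⟨fun k _ => ⟨(h k).1, fun hk => (h k).2 (Finset.mem_insert_of_mem hk)⟩,
          (h a).1, (h a).2 (Finset.mem_insert_self a S)⟩
      · rintro ⟨hR, h⟩ k
        by_cases hk : k = a
        · subst hk; exact ⟨h.1, fun _ => h.2⟩
        · exact ⟨(hR k hk).1, fun h' => (hR k hk).2 ((Finset.mem_insert.1 h').resolve_left hk)⟩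
    rw [if_congr h1 rfl rfl, if_congr h2 rfl rfl, if_congr h3 rfl rfl]
    by_cases hR : R <;> by_cases hE : E a (x a) <;> by_cases hE' : E a (x a - 1) <;>
      simp_all

lemma sgn_eq_zero (α : Fin (n + 1) → primitives F) (hα : (embedMatrix τ α).det = 0) :
    sgn τ α = 0 := by
  change ((SignType.sign (embedMatrix τ α).det : SignType) : ℤ) = 0
  rw [hα]; simp

variable [NumberField F] [IsTotallyReal F]

/-- The numerator `∑ t^β` of the generating function. -/
noncomputable def numerator (α : Fin (n + 1) → primitives F) : CoordRing F :=
  ∑ β ∈ (finite_latticePoints τ α).toFinset, monom β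

open Classical in
lemma coeff_numerator (α : Fin (n + 1) → primitives F) (β : 𝓞 F) :
    (numerator τ α).coeff β = if β ∈ latticePoints τ α then 1 else 0 := by
  rw [numerator, AddMonoidAlgebra.coeff_sum, Finsupp.finsetSum_apply]
  simp [monom, AddMonoidAlgebra.coeff_single, Finsupp.single_apply]

-- The identity "numerator = denominator times cone series": `shift_prod_inCone` with all directions
-- truncated. Functions of arbitrary support take the place of power series.
open Classical in
lemma coeff_numerator_eq_shift (hn : finrank ℚ F = n + 1) (α : Fin (n + 1) → primitives F)
    (hα : (embedMatrix τ α).det ≠ 0) :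
    (⇑(numerator τ α).coeff : 𝓞 F → ℤ) =
      shift F (∏ k, (1 - monom (α k).1)) (fun β => if InCone τ α β then 1 else 0) := by
  funext β
  rw [shift_prod_inCone τ α hα, coeff_numerator]
  refine if_congr ?_ rfl rfl
  rw [mem_latticePoints_iff τ hn α hα]
  simp

/-- The cocycle relation, cleared of denominators. -/
lemma sum_sgn_numerator_eq_zero (hn : finrank ℚ F = n + 1) (α : Fin (n + 2) → primitives F) :
    ∑ j : Fin (n + 2), ((-1 : ℤ) ^ (j : ℕ) * sgn τ (α ∘ j.succAbove)) •
      ((1 - monom (α j).1) * numerator τ (α ∘ j.succAbove)) = 0 := by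
  classical
  apply AddMonoidAlgebra.coeff_injective
  apply DFunLike.coe_injective
  -- In the `j`-th term the factor `1 - t^{α_j}` completes the denominator of the subfamily omitting
  -- `j`, so every term is the same operator `Q` applied to a signed indicator.
  let Q := shift F (∏ k, (1 - monom (α k).1))
  have hterm : ∀ j : Fin (n + 2), (⇑(((-1 : ℤ) ^ (j : ℕ) * sgn τ (α ∘ j.succAbove)) •
      ((1 - monom (α j).1) * numerator τ (α ∘ j.succAbove))).coeff : 𝓞 F → ℤ) =
      Q (((-1 : ℤ) ^ (j : ℕ) * sgn τ (α ∘ j.succAbove)) • fun β =>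
        if InCone τ (α ∘ j.succAbove) β then 1 else 0) := by
    intro j
    by_cases hj : (embedMatrix τ (α ∘ j.succAbove)).det = 0
    · rw [sgn_eq_zero τ _ hj, mul_zero, zero_smul, zero_smul, map_zero]
      rfl
    · rw [map_smul, AddMonoidAlgebra.coeff_smul, Finsupp.coe_smul, coeff_one_sub_monom_mul,
        coeff_numerator_eq_shift τ hn _ hj, ← Module.End.mul_apply, ← map_mul]
      congr 3
      exact (Fin.prod_univ_succAbove (fun k => (1 - monom (α k).1 : CoordRing F)) j).symm
  rw [AddMonoidAlgebra.coeff_sum, Finsupp.coe_finsetSum, Finset.sum_congr rfl fun j _ => hterm j,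
    ← map_sum]
  have h0 : ∑ j : Fin (n + 2), ((-1 : ℤ) ^ (j : ℕ) * sgn τ (α ∘ j.succAbove)) •
      (fun β => if InCone τ (α ∘ j.succAbove) β then 1 else 0 : 𝓞 F → ℤ) = 0 := by
    funext β
    rw [Finset.sum_apply]
    exact sum_sgn_inCone_eq_zero τ hn α β
  rw [h0, map_zero]
  rfl

end GeneratingFunctions

/-! ### Behaviour under permutations and totally positive units. -/

section Symmetries

variable {F : Type u} [Field F] {n : ℕ} (τ : Fin (n + 1) ≃ (F →+* ℝ))

lemma sgn_comp_perm (σ : Equiv.Perm (Fin (n + 1))) (α : Fin (n + 1) → primitives F) :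
    sgn τ (α ∘ σ) = ((Equiv.Perm.sign σ : ℤˣ) : ℤ) * sgn τ α := by
  change ((SignType.sign ((embedMatrix τ α).submatrix id σ).det : SignType) : ℤ) =
    _ * ((SignType.sign (embedMatrix τ α).det : SignType) : ℤ)
  rw [Matrix.det_permute']
  rcases Int.units_eq_one_or (Equiv.Perm.sign σ) with h | h <;> simp [h, Left.sign_neg]

lemma sgn_eq_zero_of_not_injective (α : Fin (n + 1) → primitives F)
    (hα : ¬ Function.Injective α) : sgn τ α = 0 := by
  obtain ⟨i, j, hij, hne⟩ : ∃ i j, α i = α j ∧ i ≠ j := by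
    simpa [Function.Injective] using hα
  change ((SignType.sign (embedMatrix τ α).det : SignType) : ℤ) = 0
  rw [Matrix.det_zero_of_column_eq hne fun k => by simp [embedMatrix, hij]]
  simp

/-- Multiplication by `ε` scales row `i` by `ε^{τ_i} > 0`. -/
lemma sgn_smul (ε : totPosUnits F) (α : Fin (n + 1) → primitives F) :
    sgn τ (ε • α) = sgn τ α := by
  have h : embedMatrix τ (ε • α) =
      Matrix.diagonal (fun i => τ i (((ε : (𝓞 F)ˣ) : 𝓞 F) : F)) * embedMatrix τ α := by
    ext i j
    simp [embedMatrix, primitives_smul_val]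
  change ((SignType.sign (embedMatrix τ (ε • α)).det : SignType) : ℤ) =
    ((SignType.sign (embedMatrix τ α).det : SignType) : ℤ)
  rw [h, Matrix.det_mul, Matrix.det_diagonal, sign_mul,
    sign_pos (Finset.prod_pos fun i _ => ε.2 (τ i)), one_mul]

lemma parallelepiped_comp_perm (σ : Equiv.Perm (Fin (n + 1))) (α : Fin (n + 1) → primitives F) :
    parallelepiped τ (α ∘ σ) = parallelepiped τ α := by
  have key : ∀ (σ : Equiv.Perm (Fin (n + 1))) (α : Fin (n + 1) → primitives F),
      parallelepiped τ α ⊆ parallelepiped τ (α ∘ σ) := by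
    rintro σ α _ ⟨x, hx, rfl⟩
    exact ⟨x ∘ σ, fun i => hx (σ i),
      (Equiv.sum_comp σ fun i => x i • embed τ ((α i).1 : F)).symm⟩
  refine Set.Subset.antisymm ?_ (key σ α)
  have := key σ⁻¹ (α ∘ σ)
  rwa [Function.comp_assoc, ← Equiv.Perm.coe_mul, mul_inv_cancel, Equiv.Perm.coe_one,
    Function.comp_id] at this

/-- Multiplication by `ε` is a positive diagonal map, so it preserves the direction of displacement
and only rescales its size, by `ε^{τ_g}`; the bound `δ` is rescaled accordingly. -/
lemma mem_latticePoints_smul {α : Fin (n + 1) → primitives F} {β : 𝓞 F}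
    (hβ : β ∈ latticePoints τ α) (ε : totPosUnits F) :
    ((ε : (𝓞 F)ˣ) : 𝓞 F) * β ∈ latticePoints τ (ε • α) := by
  obtain ⟨hpos, δ, hδ, h⟩ := hβ
  have hε : ∀ i, 0 < τ i (((ε : (𝓞 F)ˣ) : 𝓞 F) : F) := fun i => ε.2 (τ i)
  refine ⟨fun i => ?_, δ * τ (Fin.last n) (((ε : (𝓞 F)ˣ) : 𝓞 F) : F), mul_pos hδ (hε _),
    fun δ' h0 h1 => ?_⟩
  · have := mul_pos (hε i) (hpos i)
    simpa [embed] using this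
  · obtain ⟨x, hx, he⟩ := h (δ' / τ (Fin.last n) (((ε : (𝓞 F)ˣ) : 𝓞 F) : F))
      (div_pos h0 (hε _)) ((div_lt_iff₀ (hε _)).2 h1)
    refine ⟨x, hx, funext fun i => ?_⟩
    have hi := congrFun he i
    simp only [Pi.sub_apply, Finset.sum_apply, Pi.smul_apply, smul_eq_mul, embed] at hi ⊢
    have h2 : (Pi.single (Fin.last n) δ' : Fin (n + 1) → ℝ) i =
        τ i (((ε : (𝓞 F)ˣ) : 𝓞 F) : F) * (Pi.single (Fin.last n)
          (δ' / τ (Fin.last n) (((ε : (𝓞 F)ˣ) : 𝓞 F) : F)) : Fin (n + 1) → ℝ) i := by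
      by_cases hl : i = Fin.last n
      · subst hl
        simp [mul_div_cancel₀, (hε (Fin.last n)).ne']
      · simp [hl]
    have hmul : ∀ γ : 𝓞 F, τ i ((((ε : (𝓞 F)ˣ) : 𝓞 F) * γ : 𝓞 F) : F) =
        τ i (((ε : (𝓞 F)ˣ) : 𝓞 F) : F) * τ i (γ : F) := fun γ => by simp
    rw [h2, hmul, ← mul_sub, hi, Finset.mul_sum]
    refine Finset.sum_congr rfl fun j _ => ?_
    change _ = x j * τ i ((((ε : (𝓞 F)ˣ) : 𝓞 F) * (α j).1 : 𝓞 F) : F)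
    rw [hmul]
    ring

variable [NumberField F] [IsTotallyReal F]

lemma numerator_comp_perm (σ : Equiv.Perm (Fin (n + 1))) (α : Fin (n + 1) → primitives F) :
    numerator τ (α ∘ σ) = numerator τ α := by
  have : latticePoints τ (α ∘ σ) = latticePoints τ α := by
    simp only [latticePoints, parallelepiped_comp_perm]
  simp only [numerator, this]

lemma actRing_numerator (ε : totPosUnits F) (α : Fin (n + 1) → primitives F) :
    actRing ε (numerator τ α) = numerator τ (ε • α) := by
  rw [numerator, map_sum, numerator]
  refine Finset.sum_bij (fun β _ => ((ε : (𝓞 F)ˣ) : 𝓞 F) * β) ?_ ?_ ?_ ?_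
  · intro β hβ
    rw [Set.Finite.mem_toFinset] at hβ ⊢
    exact mem_latticePoints_smul τ hβ ε
  · intro β _ β' _ h
    exact (Units.mul_right_inj (ε : (𝓞 F)ˣ)).1 h
  · intro γ hγ
    rw [Set.Finite.mem_toFinset] at hγ
    refine ⟨((ε⁻¹ : totPosUnits F) : (𝓞 F)ˣ) * γ, ?_, ?_⟩
    · rw [Set.Finite.mem_toFinset]
      have := mem_latticePoints_smul τ hγ ε⁻¹
      rwa [inv_smul_smul] at this
    · change ((ε : (𝓞 F)ˣ) : 𝓞 F) * ((((ε : (𝓞 F)ˣ)⁻¹ : (𝓞 F)ˣ) : 𝓞 F) * γ) = γ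
      rw [Units.mul_inv_cancel_left]
  · intro β _
    exact actRing_monom ε β

end Symmetries

end Shintani

namespace Shintani

open CategoryTheory Limits

open AlgebraicGeometry Opposite QOpen NumberField Module

universe u

/-! ### Equivariant cochains and pullback of functions. -/

section Cochains

variable {G : Type u} [Group G] {X : Scheme.{u}} {ρ : RightAction G X}
  {A : Type u} [MulAction G A]

namespace EquivariantFamily

variable (𝔘 : EquivariantFamily ρ A)

/-- An invariant alternating family of sections is an equivariant Čech cochain. -/
lemma exists_cochain (F : Sheaf (topology ρ) AddCommGrpCat.{u}) {m : ℕ}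
    (s : 𝔘.cochains F.obj m (whole ρ))
    (hs : ∀ g : G, 𝔘.cochainsPull F.obj m (translate ρ g) s = s) :
    ∃ z : (𝔘.equivariantCechComplex F).X m, (∀ α, 𝔘.component F z α = s.1 α) ∧
      (𝔘.cechDiff F.obj m (whole ρ) s = 0 →
        ((𝔘.equivariantCechComplex F).d m (m + 1)).hom z = 0) := by
  let z : invariants (𝔘.cechPresheaf F.obj m) := ⟨s, hs⟩
  refine ⟨z, fun α => rfl, fun hd => ?_⟩
  have h : (𝔘.equivariantCechComplex F).d m (m + 1) =
      (equivariantSections ρ).map (𝔘.cechSheafDiff F m) := by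
    rw [← cechComplex_d]
    rfl
  rw [h]
  exact Subtype.ext hd

end EquivariantFamily

/-- Pullback of functions along a morphism of the site, as a ring homomorphism. -/
def pullRing (ρ : RightAction G X) {V W : QOpen ρ} (f : V ⟶ W) :
    Γ(X, W.carrier) →+* Γ(X, V.carrier) :=
  ((ρ.act (elt f)).appLE W.carrier V.carrier (le_preimage f)).hom

end Cochains

/-! ### Functions on open subsets of the punctured torus. -/

section Sections

variable {F : Type u} [Field F]

lemma le_preimage_top {X Y : Scheme.{u}} (f : X ⟶ Y) (V : X.Opens) : V ≤ f ⁻¹ᵁ (⊤ : Y.Opens) :=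
  fun _ _ => trivial

/-- An element of the coordinate ring of `𝕋` as a function on an open subset of `U`. -/
noncomputable def restrictSections (V : QOpen (puncturedAction F)) :
    CoordRing F →+* Γ((puncturedTorus F).toScheme, V.carrier) :=
  ((Scheme.ΓSpecIso (CommRingCat.of (CoordRing F))).inv ≫
    (puncturedTorus F).ι.appLE ⊤ V.carrier (le_preimage_top _ _)).hom

lemma appLE_toSections (W : (torus F).Opens) (V : QOpen (puncturedAction F))
    (h : V.carrier ≤ (puncturedTorus F).ι ⁻¹ᵁ W) (x : CoordRing F) :
    ((puncturedTorus F).ι.appLE W V.carrier h).hom (toSections W x) = restrictSections V x := by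
  have h1 : ((Scheme.ΓSpecIso (CommRingCat.of (CoordRing F))).inv ≫
      (torus F).presheaf.map (homOfLE le_top).op) ≫ (puncturedTorus F).ι.appLE W V.carrier h =
      (Scheme.ΓSpecIso (CommRingCat.of (CoordRing F))).inv ≫
        (puncturedTorus F).ι.appLE ⊤ V.carrier (le_preimage_top _ _) := by
    rw [Category.assoc, Scheme.Hom.map_appLE]
  exact congrArg (fun k => k.hom x) h1

lemma pullRing_restrictSections {V W : QOpen (puncturedAction F)} (f : V ⟶ W) (x : CoordRing F) :
    pullRing (puncturedAction F) f (restrictSections W x) =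
      restrictSections V (actRing (elt f) x) := by
  have hι : (puncturedAction F).act (elt f) ≫ (puncturedTorus F).ι =
      (puncturedTorus F).ι ≫ (torusAction F).act (elt f) := Scheme.Hom.resLE_comp_ι ..
  have h1 : ∀ (φ ψ : (puncturedTorus F).toScheme ⟶ torus F) (_ : φ = ψ),
      φ.appLE ⊤ V.carrier (le_preimage_top _ _) = ψ.appLE ⊤ V.carrier (le_preimage_top _ _) := by
    rintro φ _ rfl; rfl
  have h2 : CommRingCat.ofHom (actRing (elt f)) ≫
      (Scheme.ΓSpecIso (CommRingCat.of (CoordRing F))).inv =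
      (Scheme.ΓSpecIso (CommRingCat.of (CoordRing F))).inv ≫
        ((torusAction F).act (elt f)).appLE ⊤ ⊤ (le_preimage_top _ _) := by
    exact (Scheme.ΓSpecIso_inv_naturality (CommRingCat.ofHom (actRing (elt f)))).trans
      (congrArg _ (Scheme.Hom.appLE_eq_app _).symm)
  have h3 : ((Scheme.ΓSpecIso (CommRingCat.of (CoordRing F))).inv ≫
      (puncturedTorus F).ι.appLE ⊤ W.carrier (le_preimage_top _ _)) ≫
        ((puncturedAction F).act (elt f)).appLE W.carrier V.carrier (le_preimage f) =
      CommRingCat.ofHom (actRing (elt f)) ≫ (Scheme.ΓSpecIso (CommRingCat.of (CoordRing F))).inv ≫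
        (puncturedTorus F).ι.appLE ⊤ V.carrier (le_preimage_top _ _) := by
    rw [Category.assoc, Scheme.Hom.appLE_comp_appLE, h1 _ _ hι, reassoc_of% h2,
      Scheme.Hom.appLE_comp_appLE]
  exact congrArg (fun k => k.hom x) h3

lemma isUnit_restrictSections {n : ℕ} (α : Fin (n + 1) → primitives F)
    (V : QOpen (puncturedAction F)) (h : V.carrier ≤ (puncturedTorus F).ι ⁻¹ᵁ torusInter α) :
    IsUnit (restrictSections V (∏ i, (1 - monom (α i).1))) := by
  rw [← appLE_toSections _ V h]
  exact (isUnit_denominator α).map _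

variable [NumberField F] [IsTotallyReal F] {n : ℕ} (τ : Fin (n + 1) ≃ (F →+* ℝ))

/-- Since the denominator is a unit, this determines the component without division, and identities
between components reduce to identities in the group ring. -/
lemma shintaniComponent_mul (α : Fin (n + 1) → primitives F) :
    (show Γ((puncturedTorus F).toScheme,
        ((standardCover F).box (whole (puncturedAction F)) α).carrier) from
      shintaniComponent τ α) *
      restrictSections ((standardCover F).box (whole (puncturedAction F)) α)
        (∏ i, (1 - monom (α i).1)) =
    restrictSections ((standardCover F).box (whole (puncturedAction F)) α)
      (sgn τ α • numerator τ α) := by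
  rw [← appLE_toSections _ _ (box_le_torusInter α), ← appLE_toSections _ _ (box_le_torusInter α)]
  refine (map_mul _ _ _).symm.trans (congrArg _ ?_)
  rw [signedShintani, shintaniFunction, smul_mul_assoc, mul_assoc, IsUnit.val_inv_mul, mul_one,
    map_zsmul]
  rfl

/-- The pullback of a component of the cocycle, cleared of denominators. -/
lemma pull_shintaniComponent_mul {V : QOpen (puncturedAction F)} (α : Fin (n + 1) → primitives F)
    (f : V ⟶ (standardCover F).box (whole (puncturedAction F)) α) (ε : totPosUnits F)
    (hε : elt f = ε) :
    (show Γ((puncturedTorus F).toScheme, V.carrier) from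
      pull (structurePresheaf (puncturedAction F)) f (shintaniComponent τ α)) *
      restrictSections V (∏ i, (1 - monom (ε • α i).1)) =
    restrictSections V (sgn τ (ε • α) • numerator τ (ε • α)) := by
  subst hε
  have h := congrArg (pullRing (puncturedAction F) f) (shintaniComponent_mul τ α)
  rw [map_mul, pullRing_restrictSections, pullRing_restrictSections, map_zsmul, actRing_numerator,
    ← sgn_smul τ (elt f) α, map_prod] at h
  simp only [map_sub, map_one, actRing_monom] at h
  exact h

end Sections

end Shintani

namespace Shintani

open CategoryTheory Limits

open AlgebraicGeometry Opposite QOpen NumberField Module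

universe u

/-! ### The Shintani cochain is alternating, invariant and closed. -/

section ShintaniCocycle

variable {F : Type u} [Field F] [NumberField F] [IsTotallyReal F] {n : ℕ}
  (τ : Fin (n + 1) ≃ (F →+* ℝ))

lemma pull_incl_shintaniComponent_mul {V : QOpen (puncturedAction F)}
    (α : Fin (n + 1) → primitives F)
    (h : V.carrier ≤ ((standardCover F).box (whole (puncturedAction F)) α).carrier) :
    (show Γ((puncturedTorus F).toScheme, V.carrier) from
      pull (structurePresheaf (puncturedAction F)) (incl h) (shintaniComponent τ α)) *
      restrictSections V (∏ i, (1 - monom (α i).1)) =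
    restrictSections V (sgn τ α • numerator τ α) := by
  have := pull_shintaniComponent_mul τ α (incl h) 1 (elt_incl h)
  simpa only [one_smul] using this

lemma shintaniComponent_mem_cochains :
    shintaniComponent τ ∈ (standardCover F).cochains
      (structureSheaf (puncturedAction F)).obj n (whole (puncturedAction F)) := by
  refine ⟨fun σ α => ?_, fun α hα => ?_⟩
  -- The denominator and the numerator are symmetric in the `α_i`, so after clearing the unit
  -- denominator only the sign of the determinant changes.
  · refine (isUnit_restrictSections α _ (box_le_torusInter α)).mul_left_injective ?_
    have h1 := pull_incl_shintaniComponent_mul τ (α ∘ σ)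
      ((standardCover F).box_le_comp (whole (puncturedAction F)) α σ)
    have h2 : ∏ i, (1 - monom ((α ∘ σ) i).1 : CoordRing F) = ∏ i, (1 - monom (α i).1) :=
      Equiv.prod_comp σ fun i => (1 - monom (α i).1 : CoordRing F)
    rw [h2, sgn_comp_perm, numerator_comp_perm] at h1
    refine h1.trans ?_
    refine Eq.trans ?_ (smul_mul_assoc ((Equiv.Perm.sign σ : ℤˣ) : ℤ) (show
      Γ((puncturedTorus F).toScheme, ((standardCover F).box (whole (puncturedAction F)) α).carrier)
      from shintaniComponent τ α) _).symm
    rw [shintaniComponent_mul, mul_smul, map_zsmul]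
  · have h : signedShintani τ α = 0 := by
      rw [signedShintani, sgn_eq_zero_of_not_injective τ α hα, zero_smul]
    rw [shintaniComponent, h]
    exact map_zero _

/-- The family of the functions `sgn(α) 𝒢_{σ_α}`, as an alternating cochain. -/
noncomputable def shintaniCochain : (standardCover F).cochains
    (structureSheaf (puncturedAction F)).obj n (whole (puncturedAction F)) :=
  ⟨shintaniComponent τ, shintaniComponent_mem_cochains τ⟩

lemma cochainsPull_shintaniCochain (ε : totPosUnits F) :
    (standardCover F).cochainsPull (structureSheaf (puncturedAction F)).obj n
      (translate (puncturedAction F) ε) (shintaniCochain τ) = shintaniCochain τ := by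
  refine Subtype.ext (funext fun α => ?_)
  refine (isUnit_restrictSections α _ (box_le_torusInter α)).mul_left_injective ?_
  -- The action uses the component at `ε⁻¹ α`; pulling back by `[ε]` turns its numerator and
  -- denominator into those of `α`.
  have h := pull_shintaniComponent_mul τ (ε⁻¹ • α)
    ((standardCover F).boxHom (translate (puncturedAction F) ε) α) ε rfl
  simp only [Pi.smul_apply, smul_inv_smul] at h
  exact h.trans (shintaniComponent_mul τ α).symm

/-- Multiplying by the product of all `g + 1` factors `1 - t^{α_i}`, a unit on `U_α`, turns the
alternating sum into `sum_sgn_numerator_eq_zero`. -/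
lemma cechDiff_shintaniCochain (hn : finrank ℚ F = n + 1) :
    (standardCover F).cechDiff (structureSheaf (puncturedAction F)).obj n
      (whole (puncturedAction F)) (shintaniCochain τ) = 0 := by
  refine Subtype.ext (funext fun α => ?_)
  let V := (standardCover F).box (whole (puncturedAction F)) α
  have hle : ∀ j : Fin (n + 2), V.carrier ≤ ((standardCover F).box
      (whole (puncturedAction F)) (α ∘ j.succAbove)).carrier := fun j =>
    (standardCover F).box_le_comp (whole (puncturedAction F)) α j.succAbove
  let s : Fin (n + 2) → Γ((puncturedTorus F).toScheme, V.carrier) := fun j =>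
    pull (structurePresheaf (puncturedAction F)) (incl (hle j))
      (shintaniComponent τ (α ∘ j.succAbove))
  have hs : ∀ j, s j * restrictSections V (∏ i, (1 - monom (α (j.succAbove i)).1)) =
      restrictSections V (sgn τ (α ∘ j.succAbove) • numerator τ (α ∘ j.succAbove)) := fun j =>
    pull_incl_shintaniComponent_mul τ (α ∘ j.succAbove) (hle j)
  have hunit : ∀ j : Fin (n + 2),
      IsUnit (restrictSections V (∏ i, (1 - monom (α (j.succAbove i)).1))) := fun j =>
    isUnit_restrictSections (α ∘ j.succAbove) V ((hle j).trans (box_le_torusInter _))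
  have hall : IsUnit (restrictSections V (∏ i, (1 - monom (α i).1))) := by
    rw [map_prod, IsUnit.prod_univ_iff]
    intro i
    -- There are `n + 2 ≥ 2` indices, so factor `i` occurs in the denominator of the subfamily
    -- omitting some `j ≠ i`.
    obtain ⟨j, hj⟩ := exists_ne i
    obtain ⟨k, rfl⟩ := Fin.exists_succAbove_eq hj.symm
    have := hunit j
    rw [map_prod, IsUnit.prod_univ_iff] at this
    exact this k
  refine hall.mul_left_injective ?_
  change (∑ j : Fin (n + 2), (-1 : ℤ) ^ (j : ℕ) • s j) * _ = 0 * _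
  rw [zero_mul, Finset.sum_mul, ← map_zero (restrictSections V),
    ← sum_sgn_numerator_eq_zero τ hn α, map_sum]
  refine Finset.sum_congr rfl fun j _ => ?_
  rw [Fin.prod_univ_succAbove _ j, map_mul, mul_smul, map_zsmul, smul_mul_assoc, mul_left_comm, hs,
    ← map_mul, mul_smul_comm]

end ShintaniCocycle

end Shintani

/-- Alternation and invariance are contained in the existence of `𝒢`: they are the conditions for a
family to be an element of the equivariant Čech complex. The degree is `g = n + 1`, so `n` is the
cohomological degree `g - 1`. -/
theorem proposition4p2 {F : Type*} [Field F] [NumberField F] [NumberField.IsTotallyReal F]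
    {n : ℕ} (hn : Module.finrank ℚ F = n + 1) (τ : Fin (n + 1) ≃ (F →+* ℝ)) :
    ∃ 𝒢 : ((Shintani.standardCover F).equivariantCechComplex
        (Shintani.structureSheaf (Shintani.puncturedAction F))).X n,
      (∀ α : Fin (n + 1) → Shintani.primitives F,
        (Shintani.standardCover F).component
            (Shintani.structureSheaf (Shintani.puncturedAction F)) 𝒢 α =
          Shintani.shintaniComponent τ α) ∧
      (((Shintani.standardCover F).equivariantCechComplex
        (Shintani.structureSheaf (Shintani.puncturedAction F))).d n (n + 1)).hom 𝒢 = 0 ∧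
      ∃! c : Shintani.equivariantCohomology (Shintani.puncturedAction F) n
          (Shintani.structureSheaf (Shintani.puncturedAction F)),
        (Shintani.standardCover F).IsClassOf
          (Shintani.structureSheaf (Shintani.puncturedAction F)) 𝒢 c := by
  obtain ⟨z, hz, hd⟩ := (Shintani.standardCover F).exists_cochain
    (Shintani.structureSheaf (Shintani.puncturedAction F)) (Shintani.shintaniCochain τ)
    (Shintani.cochainsPull_shintaniCochain τ)
  have hd' := hd (Shintani.cechDiff_shintaniCochain τ hn)
  exact ⟨z, hz, hd', (Shintani.standardCover F).existsUnique_isClassOf _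
    ((Shintani.standardCover F).isResolution_cech _
      (Shintani.exists_mem_standardCover_opens τ)) z hd'⟩
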